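/- Let $\mathcal X,\mathcal Y$ be finite alphabets, $P$ a probability distribution on $\mathcal X$ and $W(\cdot\mid\cdot)$ a discrete memoryless channel from $\mathcal X$ to $\mathcal Y$. For each number of pixels $n$ let $\Pi_n$ be a commutative group of permutations of $\{1,\dots,n\}$ (under composition) such that: $\Pi_n$ has more than one element for all large $n$; $|\Pi_n|=O(n^{\alpha})$ for some constant $\alpha$; and, uniformly over the non-identity $\pi\in\Pi_n$, the number of cycles of $\pi$ of length at least $2$ is $o(n/\log n)$ and the number of fixed points of $\pi$ is $o(n)$. Let the reference image $\mathbf X=(X_1,\dots,X_n)$ have i.i.d. pixels with law $P$, let $\tilde{\mathbf Y}$ be the output of $W$ with input $\mathbf X$, so that $\Pr(\tilde{\mathbf Y}=\mathbf y\mid \mathbf X=\mathbf x)=\prod_{i=1}^n W(y_i\mid x_i)$, let $\pi$ be uniform on $\Pi_n$ and independent of $(\mathbf X,\tilde{\mathbf Y})$, and let $\mathbf Y=\tilde{\mathbf Y}_\pi$ be observed, where $(\mathbf y_\pi)_i=y_{\pi(i)}$. A registration rule $\Phi^{(n)}$ outputs a permutation $\hat\pi=\hat\pi(\mathbf X,\mathbf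 Y)\in\Pi_n$; its error probability is $P_e(\Phi^{(n)})=\Pr(\hat\pi\ne\pi^{-1})$, and its error exponent is $\mathcal E(\Phi)=\lim_{n\to\infty}-\tfrac1n\log P_e(\Phi^{(n)})$. The maximum mutual information (MMI) rule outputs a $\hat\pi_{\rm MMI}\in\arg\max_{\pi\in\Pi_n}\hat I(\mathbf X;\mathbf Y_\pi)$, where $\hat I(\mathbf x;\mathbf y)$ is the mutual information of the empirical distribution $\hat P(a,b)=\frac1n\sum_{i=1}^n\mathbf 1\{x_i=a,\,y_i=b\}$; it does not depend on $P$ or $W$. The maximum likelihood (ML) rule, which knows $W$, outputs a $\hat\pi_{\rm ML}\in\arg\max_{\pi\in\Pi_n}\prod_{i=1}^n W(Y_{\pi(i)}\mid X_i)$. In both rules ties are broken in an arbitrary way. Theorem. The error probabilities of both rules are positive for all large $n$, the limits defining their error exponents exist and are finite, and $$\mathcal E(\Phi_{\rm MMI})=\mathcal E(\Phi_{\rm ML}).$$ -/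

import Mathlib

open Filter Topology Asymptotics

namespace ImageRegistration

/-- The image `y` transformed by the permutation `π` of its pixels: `(y_π)_i = y_{π(i)}`. -/
def transform {𝒴 : Type*} {n : ℕ} (π : Equiv.Perm (Fin n)) (y : Fin n → 𝒴) : Fin n → 𝒴 :=
  fun i => y (π i)

open Classical in
/-- The empirical joint distribution (joint type) of two images with `n` pixels:
the fraction of pixels `i` with `(x_i, y_i) = (a, b)`. -/
noncomputable def empiricalDist {𝒳 𝒴 : Type*} {n : ℕ} (x : Fin n → 𝒳) (y : Fin n → 𝒴)
    (a : 𝒳) (b : 𝒴) : ℝ :=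
  (1 / (n : ℝ)) * ∑ i : Fin n, if x i = a ∧ y i = b then 1 else 0

/-- The mutual information (in nats) of a joint distribution `p` on `𝒳 × 𝒴`, with the convention
`0 log 0 = 0`. -/
noncomputable def mutualInfo {𝒳 𝒴 : Type*} [Fintype 𝒳] [Fintype 𝒴] (p : 𝒳 → 𝒴 → ℝ) : ℝ :=
  ∑ a, ∑ b, p a b * Real.log (p a b / ((∑ b', p a b') * ∑ a', p a' b))

/-- The empirical mutual information of two images. -/
noncomputable def empiricalMI {𝒳 𝒴 : Type*} [Fintype 𝒳] [Fintype 𝒴] {n : ℕ}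
    (x : Fin n → 𝒳) (y : Fin n → 𝒴) : ℝ :=
  mutualInfo (empiricalDist x y)

/-- The likelihood of the output `y` given the input `x` over the memoryless channel `W`
(`W a b` is the probability of the output `b` given the input `a`). -/
noncomputable def likelihood {𝒳 𝒴 : Type*} {n : ℕ} (W : 𝒳 → 𝒴 → ℝ)
    (x : Fin n → 𝒳) (y : Fin n → 𝒴) : ℝ :=
  ∏ i, W (x i) (y i)

/-- A registration rule for `n` pixels returns a permutation, given the reference image and the
transformed noisy image. -/
abbrev Rule (𝒳 𝒴 : Type*) (n : ℕ) : Type _ :=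
  (Fin n → 𝒳) → (Fin n → 𝒴) → Equiv.Perm (Fin n)

/-- `φ` is a maximum mutual information rule over the transformations `G`: it returns a maximizer
over `π ∈ G` of the empirical mutual information of `x` and `y_π` (ties are broken arbitrarily). -/
def IsMMI {𝒳 𝒴 : Type*} [Fintype 𝒳] [Fintype 𝒴] {n : ℕ}
    (G : Subgroup (Equiv.Perm (Fin n))) (φ : Rule 𝒳 𝒴 n) : Prop :=
  ∀ x y, φ x y ∈ G ∧ ∀ π ∈ G, empiricalMI x (transform π y) ≤ empiricalMI x (transform (φ x y) y)

/-- `φ` is a maximum likelihood rule over the transformations `G` for the channel `W`: it returns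
a maximizer over `π ∈ G` of `∏ i, W(y_{π(i)} | x_i)` (ties are broken arbitrarily). -/
def IsML {𝒳 𝒴 : Type*} {n : ℕ} (W : 𝒳 → 𝒴 → ℝ)
    (G : Subgroup (Equiv.Perm (Fin n))) (φ : Rule 𝒳 𝒴 n) : Prop :=
  ∀ x y, φ x y ∈ G ∧
    ∀ π ∈ G, likelihood W x (transform π y) ≤ likelihood W x (transform (φ x y) y)

open Classical in
/-- The error probability `ℙ(φ(X, Y) ≠ π⁻¹)` of the rule `φ`, where `π` is uniform on `G`, the
pixels of the reference image `X` are i.i.d. with law `P`, `Y'` is the output of the memoryless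
channel `W` with input `X`, and `Y = Y'_π` is observed. -/
noncomputable def errorProb {𝒳 𝒴 : Type*} [Fintype 𝒳] [Fintype 𝒴] {n : ℕ}
    (P : 𝒳 → ℝ) (W : 𝒳 → 𝒴 → ℝ) (G : Subgroup (Equiv.Perm (Fin n))) (φ : Rule 𝒳 𝒴 n) : ℝ :=
  (1 / (Nat.card G : ℝ)) * ∑ π : G, ∑ x : Fin n → 𝒳, ∑ y' : Fin n → 𝒴,
    (∏ i, P (x i)) * likelihood W x y' *
      if φ x (transform (π : Equiv.Perm (Fin n)) y') ≠ (π : Equiv.Perm (Fin n))⁻¹ then 1 else 0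

/-- The error probabilities `Pe n` are eventually positive and have the (finite) error exponent
`E = lim - (1 / n) log (Pe n)`. -/
def HasErrorExponent (Pe : ℕ → ℝ) (E : ℝ) : Prop :=
  (∀ᶠ n in atTop, 0 < Pe n) ∧
    Tendsto (fun n : ℕ => -(1 / (n : ℝ)) * Real.log (Pe n)) atTop (𝓝 E)

/-- The number `κ_π` of cycles of `π` of length at least two. -/
def numCycles {n : ℕ} (π : Equiv.Perm (Fin n)) : ℕ := π.cycleType.card

/-- The size of the identity block (the set of fixed points) of `π`. -/
noncomputable def identityBlockSize {n : ℕ} (π : Equiv.Perm (Fin n)) : ℕ :=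
  {i : Fin n | π i = i}.ncard

end ImageRegistration

/-!
Both rules have the error exponent `-log r`, where `r` is the square of the largest singular value
of the matrix `K a b = √(P a * W a b)`, that is, the largest eigenvalue of `gram K = Kᵀ K`.

Let `σ ≠ 1` be the composition of the true transformation with a competing decision. A sum over all
pairs of images of a product over `i` of functions of `(x i, y i, y (σ i))` is a partition function
`permSum σ M` along the cycles of `σ`. If `M` is substochastic, such a sum is at most
`card 𝒴 ^ c`, where `c` counts the cycles including the fixed points (`permSum_le_card_pow`); by
assumption `c = o(n)`, so that all these sums depend on `σ` only through subexponential factors.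
The number of transformations is polynomial, and it suffices to treat each `σ` separately.

*Upper bound for the maximum mutual information rule.* Suppose that `y_σ` has at least the
empirical mutual information of `y`. If `q` and `q'` are the joint types of `(x, y)` and
`(x, y_σ)`, which have the same marginals, then Gibbs' inequality and `I(q) ≤ I(q')` bound the
probability of `(x, y)` by `r ^ n ∏ i, q(x i | y i) q'(y (σ i) | x i)`
(`prob_le_of_empiricalMI_le`). For fixed `q` and `q'` the product sums to at most `card 𝒴 ^ c`,
and there are polynomially many types.

*Lower bound for every rule.* A rule cannot be right both for `1` and for `σ`, so its error
probability is at least `(card G)⁻¹ ∑ P(x) min (W(y | x)) (W(y_σ | x))`. Replacing the minimum by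
the geometric mean gives `permSum σ (gram K)`, which is at least `r ^ n` as `gram K` is positive
semidefinite (`pow_le_permSum_gram`). The minimum is within `exp (o(n))` of the geometric mean
unless the log-likelihood ratio is of order `n`. Such images are negligible by an exponential
tilting argument: the first-order perturbation of `gram K` by the tilt is antisymmetric, so it does
not change the top eigenvalue to first order (`exists_tilted_superEigenvector`). Neither
irreducibility of `gram K` nor a spectral gap is needed, only images with pixels in the support of
a nonnegative top eigenvector.

The maximum likelihood rule minimizes the error probability, hence it inherits the upper bound from
the maximum mutual information rule.
-/

namespace ImageRegistration

/-! ### Sums of products along the cycles of a permutation -/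

/-- The partition function of the pair interaction `M` along the cycles of `σ`: the sum over all
images `y` of `∏ i, M (y i) (y (σ i))`. -/
def permSum {β : Type*} [Fintype β] {n : ℕ} (σ : Equiv.Perm (Fin n)) (M : β → β → ℝ) : ℝ :=
  ∑ y : Fin n → β, ∏ i, M (y i) (y (σ i))

lemma sum_sum_update {ι β : Type*} [Fintype ι] [DecidableEq ι] [Fintype β] (v : ι)
    (F : (ι → β) → ℝ) :
    ∑ y : ι → β, ∑ b, F (Function.update y v b) = Fintype.card β * ∑ y, F y := by
  have hinv : Function.Involutive
      (fun p : (ι → β) × β => (Function.update p.1 v p.2, p.1 v)) := by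
    rintro ⟨y, b⟩
    simp
  rw [← Fintype.sum_prod_type' (f := fun (y : ι → β) b => F (Function.update y v b)),
    Fintype.sum_equiv hinv.toPerm (fun p : (ι → β) × β => F (Function.update p.1 v p.2))
      (fun p : (ι → β) × β => F p.1) (fun p => rfl),
    Fintype.sum_prod_type]
  simp [Finset.mul_sum]

/-- If `S` contains no full orbit of `σ`, the edges `i → σ i` with `i ∈ S` form a union of directed
paths, and summing out the end points of the paths one at a time gains a factor `card β` for
each edge. -/
lemma card_pow_mul_sum_prod_le {β : Type*} [Fintype β] {n : ℕ} (σ : Equiv.Perm (Fin n))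
    (M : β → β → ℝ) (hM : ∀ a b, 0 ≤ M a b) (hrow : ∀ a, ∑ b, M a b ≤ 1) (S : Finset (Fin n))
    (hS : ∀ i, ∃ k : ℕ, (σ ^ k) i ∉ S) :
    (Fintype.card β : ℝ) ^ S.card * ∑ y : Fin n → β, ∏ i ∈ S, M (y i) (y (σ i))
      ≤ (Fintype.card β : ℝ) ^ n := by
  induction hm : S.card generalizing S with
  | zero =>
    rw [Finset.card_eq_zero] at hm
    subst hm
    simp
  | succ m ih =>
    -- some edge of `S` leads out of `S`
    obtain ⟨i, hi, hiS⟩ : ∃ i ∈ S, σ i ∉ S := by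
      by_contra! hcon
      obtain ⟨i, hi⟩ : S.Nonempty := Finset.card_pos.1 (by omega)
      obtain ⟨k, hk⟩ := hS i
      apply hk
      clear hk
      induction k with
      | zero => simpa
      | succ k ihk => rw [pow_succ']; exact hcon _ ihk
    have hne : i ≠ σ i := fun h => hiS (h ▸ hi)
    have hcard : (S.erase i).card = m := by rw [Finset.card_erase_of_mem hi, hm]; rfl
    have := ih (S.erase i)
      (fun j => (hS j).imp fun k hk h => hk (Finset.mem_of_mem_erase h)) hcard
    refine le_trans ?_ this
    rw [pow_succ, mul_assoc]
    refine mul_le_mul_of_nonneg_left ?_ (by positivity)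
    rw [← sum_sum_update (σ i)]
    refine Finset.sum_le_sum fun y _ => ?_
    have hsplit : ∀ b, ∏ j ∈ S, M (Function.update y (σ i) b j) (Function.update y (σ i) b (σ j))
        = M (y i) b * ∏ j ∈ S.erase i, M (y j) (y (σ j)) := by
      intro b
      rw [← Finset.mul_prod_erase S _ hi]
      congr 1
      · rw [Function.update_of_ne hne, Function.update_self]
      · refine Finset.prod_congr rfl fun j hj => ?_
        have hj' := Finset.mem_erase.1 hj
        rw [Function.update_of_ne (fun h : j = σ i => hiS (h ▸ hj'.2)),
          Function.update_of_ne (fun h => hj'.1 (σ.injective h))]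
    simp_rw [hsplit]
    rw [← Finset.sum_mul]
    exact mul_le_of_le_one_left (Finset.prod_nonneg fun j _ => hM _ _) (hrow _)

lemma permSum_le_card_pow {β : Type*} [Fintype β] [Nonempty β] {n : ℕ} (σ : Equiv.Perm (Fin n))
    (M : β → β → ℝ) (hM : ∀ a b, 0 ≤ M a b) (hrow : ∀ a, ∑ b, M a b ≤ 1) (R : Finset (Fin n))
    (hR : ∀ i, ∃ k : ℕ, (σ ^ k) i ∈ R) :
    permSum σ M ≤ (Fintype.card β : ℝ) ^ R.card := by
  have hcard : (0 : ℝ) < Fintype.card β := by exact_mod_cast Fintype.card_pos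
  have h := card_pow_mul_sum_prod_le σ M hM hrow Rᶜ (fun i => by simpa using hR i)
  have hn : n = Rᶜ.card + R.card := by
    rw [Finset.card_compl_add_card, Fintype.card_fin]
  have hpow : (Fintype.card β : ℝ) ^ n
      = (Fintype.card β : ℝ) ^ Rᶜ.card * (Fintype.card β : ℝ) ^ R.card := by
    rw [← pow_add, ← hn]
  rw [hpow] at h
  refine le_trans (Finset.sum_le_sum fun y _ => ?_) (le_of_mul_le_mul_left h (by positivity))
  refine Finset.prod_le_prod_of_subset_of_le_one (Finset.subset_univ _)
    (fun i _ => hM _ _) (fun i _ _ => ?_)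
  exact (Finset.single_le_sum (f := fun b => M (y i) b) (fun b _ => hM _ _)
    (Finset.mem_univ _)).trans (hrow _)

/-- A positive super-eigenvector `g` of `M` turns `M` into a substochastic matrix after
conjugation by `g`, which leaves the products along cycles unchanged. -/
lemma permSum_le_of_superEigenvector {β : Type*} [Fintype β] [Nonempty β] {n : ℕ}
    (σ : Equiv.Perm (Fin n)) (M : β → β → ℝ) (hM : ∀ a b, 0 ≤ M a b) (g : β → ℝ)
    (hg : ∀ b, 0 < g b) (r : ℝ) (hr : 0 < r) (hrow : ∀ a, ∑ b, M a b * g b ≤ r * g a)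
    (R : Finset (Fin n)) (hR : ∀ i, ∃ k : ℕ, (σ ^ k) i ∈ R) :
    permSum σ M ≤ r ^ n * (Fintype.card β : ℝ) ^ R.card := by
  have key : permSum σ M = r ^ n * permSum σ (fun a b => M a b * g b / (r * g a)) := by
    unfold permSum
    rw [Finset.mul_sum]
    refine Finset.sum_congr rfl fun y _ => ?_
    rw [Finset.prod_div_distrib, Finset.prod_mul_distrib, Finset.prod_mul_distrib,
      Equiv.prod_comp σ (fun i => g (y i))]
    have : (∏ i, g (y i)) ≠ 0 := (Finset.prod_pos fun i _ => hg _).ne'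
    simp only [Finset.prod_const, Finset.card_univ, Fintype.card_fin]
    field_simp
  rw [key]
  refine mul_le_mul_of_nonneg_left (permSum_le_card_pow σ _ (fun a b => ?_) (fun a => ?_) R hR)
    (by positivity)
  · exact div_nonneg (mul_nonneg (hM _ _) (hg _).le) (mul_pos hr (hg _)).le
  · rw [← Finset.sum_div, div_le_one (mul_pos hr (hg _))]
    exact hrow a

/-- For `R` one takes the fixed points of `σ` and one point of each nontrivial cycle. -/
lemma exists_orbit_transversal {n : ℕ} (σ : Equiv.Perm (Fin n)) :
    ∃ R : Finset (Fin n), R.card ≤ numCycles σ + identityBlockSize σ ∧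
      ∀ i, ∃ k : ℕ, (σ ^ k) i ∈ R := by
  classical
  have hrep : ∀ c : Equiv.Perm (Fin n), ∃ i : Fin n → Fin n,
      c ∈ σ.cycleFactorsFinset → ∀ j, c j ≠ j → c (i j) ≠ i j ∧ ∀ j', i j' = i j := by
    intro c
    by_cases hc : c ∈ σ.cycleFactorsFinset
    · obtain ⟨i, hi, -⟩ := (Equiv.Perm.mem_cycleFactorsFinset_iff.1 hc).1
      exact ⟨fun _ => i, fun _ j _ => ⟨hi, fun _ => rfl⟩⟩
    · exact ⟨id, fun h => absurd h hc⟩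
  choose r hr using hrep
  rcases n with _ | n
  · exact ⟨∅, by simp, fun i => i.elim0⟩
  refine ⟨σ.cycleFactorsFinset.image (fun c => r c 0) ∪ Finset.univ.filter (fun i => σ i = i),
    ?_, fun i => ?_⟩
  · refine (Finset.card_union_le _ _).trans (add_le_add ?_ ?_)
    · refine Finset.card_image_le.trans ?_
      rw [numCycles, Equiv.Perm.cycleType_def, Multiset.card_map]
      rfl
    · rw [identityBlockSize, Set.ncard_eq_toFinset_card']
      simp
  · by_cases hi : σ i = i
    · exact ⟨0, by simp [hi]⟩
    · have hc : σ.cycleOf i ∈ σ.cycleFactorsFinset :=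
        Equiv.Perm.cycleOf_mem_cycleFactorsFinset_iff.2 (Equiv.Perm.mem_support.2 hi)
      have hii : σ.cycleOf i i ≠ i := by simpa using hi
      obtain ⟨h1, h2⟩ := hr _ hc i hii
      rw [← h2 0] at h1
      have hs : σ.SameCycle i (r (σ.cycleOf i) 0) := by
        by_contra hns
        exact h1 (Equiv.Perm.cycleOf_apply_of_not_sameCycle hns)
      obtain ⟨k, hk⟩ := hs.exists_nat_pow_eq
      exact ⟨k, by
        rw [hk]
        exact Finset.mem_union_left _ (Finset.mem_image_of_mem _ hc)⟩

/-- Let the edges `i → σ i` carry powers of `M`. Summing out the pixel `0` either splits off the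
trace of a power or merges two edges into one whose powers are multiplied, so a lower bound for the
traces of all powers of `M` extends to the sum over all cycles. -/
lemma pow_sum_le_sum_prod_pow {β : Type*} [Fintype β] [DecidableEq β] (M : Matrix β β ℝ) (r : ℝ)
    (hr : 0 ≤ r) (htr : ∀ k, r ^ k ≤ (M ^ k).trace) {n : ℕ} (σ : Equiv.Perm (Fin n))
    (k : Fin n → ℕ) :
    r ^ (∑ i, k i) ≤ ∑ y : Fin n → β, ∏ i, (M ^ k i) (y i) (y (σ i)) := by
  induction n with
  | zero => simp
  | succ n ih =>
    obtain ⟨⟨p, e⟩, rfl⟩ := Equiv.Perm.decomposeFin.symm.surjective σ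
    rw [← (Fin.consEquiv fun _ : Fin (n + 1) => β).sum_comp, Fintype.sum_prod_type_right]
    simp only [Fin.consEquiv_apply]
    refine Fin.cases ?_ (fun q => ?_) p
    · -- `0` is a fixed point
      simp only [Fin.prod_univ_succ, Equiv.Perm.decomposeFin_symm_apply_zero, Fin.cons_zero,
        Equiv.Perm.decomposeFin_symm_apply_succ, Equiv.swap_self, Equiv.refl_apply, Fin.cons_succ,
        Fin.sum_univ_succ, ← Finset.sum_mul]
      rw [← Finset.mul_sum, pow_add]
      exact mul_le_mul (htr _) (ih e fun i => k i.succ) (by positivity)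
        ((pow_nonneg hr _).trans (htr _))
    · -- `0` lies between `(e⁻¹ q).succ` and `q.succ`; removing it multiplies the two matrices
      set j := e.symm q with hj
      have hej : e j = q := by simp [hj]
      have hsum : ∑ i, k i = ∑ i, (Function.update (fun i : Fin n => k i.succ) j
          (k j.succ + k 0)) i := by
        rw [Fin.sum_univ_succ, ← Finset.add_sum_erase _ _ (Finset.mem_univ j),
          ← Finset.add_sum_erase _ (Function.update _ _ _) (Finset.mem_univ j),
          Function.update_self, ← add_assoc, add_comm (k 0)]
        congr 1
        exact Finset.sum_congr rfl fun i hi => by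
          rw [Function.update_of_ne (Finset.ne_of_mem_erase hi)]
      rw [hsum]
      refine (ih e _).trans_eq (Finset.sum_congr rfl fun y _ => ?_)
      rw [← Finset.mul_prod_erase _ _ (Finset.mem_univ j), Function.update_self, pow_add,
        Matrix.mul_apply, Finset.sum_mul]
      refine Finset.sum_congr rfl fun b _ => ?_
      rw [Fin.prod_univ_succ, ← Finset.mul_prod_erase _ _ (Finset.mem_univ j)]
      simp only [Equiv.Perm.decomposeFin_symm_apply_zero, Fin.cons_zero, Fin.cons_succ,
        Equiv.Perm.decomposeFin_symm_apply_succ, hej, Equiv.swap_apply_right]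
      rw [← mul_assoc, mul_comm ((M ^ k 0) b (y q))]
      congr 1
      refine Finset.prod_congr rfl fun i hi => ?_
      have hne : i ≠ j := Finset.ne_of_mem_erase hi
      rw [Function.update_of_ne hne, Equiv.swap_apply_of_ne_of_ne (Fin.succ_ne_zero _)
        (fun h => hne (e.injective ((Fin.succ_injective _ h).trans hej.symm))), Fin.cons_succ]

open scoped MatrixOrder in
lemma dotProduct_mulVec_le_trace {β : Type*} [Fintype β] [DecidableEq β]
    {N : Matrix β β ℝ} (hN : N.PosSemidef) (v : β → ℝ) (hv : ∑ b, v b ^ 2 = 1) :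
    v ⬝ᵥ N.mulVec v ≤ N.trace := by
  obtain ⟨C, rfl⟩ := CStarAlgebra.nonneg_iff_eq_star_mul_self.1 hN.nonneg
  have h1 : v ⬝ᵥ (star C * C).mulVec v = ∑ i, (∑ j, C i j * v j) ^ 2 := by
    rw [← Matrix.mulVec_mulVec, Matrix.dotProduct_mulVec]
    simp [dotProduct, Matrix.vecMul, Matrix.mulVec, pow_two, mul_comm]
  have h2 : (star C * C).trace = ∑ i, ∑ j, C i j ^ 2 := by
    rw [Finset.sum_comm]
    simp [Matrix.trace, Matrix.mul_apply, Matrix.star_eq_conjTranspose, pow_two]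
  rw [h1, h2]
  refine Finset.sum_le_sum fun i _ => ?_
  simpa [hv] using Finset.sum_mul_sq_le_sq_mul_sq Finset.univ (C i) v

/-! ### Gram matrices and their top eigenvectors -/

/-- The Gram matrix `Kᵀ K` of the columns of `K`. -/
def gram {α β : Type*} [Fintype α] (K : α → β → ℝ) (b b' : β) : ℝ := ∑ a, K a b * K a b'

lemma gram_nonneg {α β : Type*} [Fintype α] {K : α → β → ℝ} (hK : ∀ a b, 0 ≤ K a b) (b b' : β) :
    0 ≤ gram K b b' := Finset.sum_nonneg fun _ _ => mul_nonneg (hK _ _) (hK _ _)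

lemma gram_comm {α β : Type*} [Fintype α] (K : α → β → ℝ) (b b' : β) :
    gram K b b' = gram K b' b := Finset.sum_congr rfl fun _ _ => mul_comm _ _

/-- An eigenvalue of a Gram matrix bounds its cyclic sums from below: all powers are positive
semidefinite, so their traces dominate the powers of the eigenvalue. -/
lemma pow_le_permSum_gram {α β : Type*} [Fintype α] [Fintype β] (K : α → β → ℝ) (r : ℝ)
    (hr : 0 ≤ r) (v : β → ℝ) (hv : ∑ b, v b ^ 2 = 1)
    (heig : ∀ b, ∑ b', gram K b b' * v b' = r * v b) {n : ℕ} (σ : Equiv.Perm (Fin n)) :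
    r ^ n ≤ permSum σ (gram K) := by
  classical
  have hpsd : (Matrix.of (gram K)).PosSemidef := by
    have : Matrix.of (gram K) = (Matrix.of K).conjTranspose * Matrix.of K := by
      ext b b'
      simp [gram, Matrix.mul_apply]
    rw [this]
    exact Matrix.posSemidef_conjTranspose_mul_self _
  have hmul : (Matrix.of (gram K)).mulVec v = r • v := by
    ext b
    simpa [Matrix.mulVec, dotProduct] using heig b
  have hpow : ∀ k : ℕ, (Matrix.of (gram K) ^ k).mulVec v = r ^ k • v := by
    intro k
    induction k with
    | zero => simp
    | succ k ih => rw [pow_succ, ← Matrix.mulVec_mulVec, hmul, Matrix.mulVec_smul, ih, smul_smul,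
        ← pow_succ']
  have htr : ∀ k, r ^ k ≤ (Matrix.of (gram K) ^ k).trace := by
    intro k
    have h := dotProduct_mulVec_le_trace (hpsd.pow k) v hv
    rw [hpow, dotProduct_smul] at h
    have hvv : v ⬝ᵥ v = 1 := by simpa [dotProduct, pow_two] using hv
    simpa [hvv] using h
  simpa [permSum] using pow_sum_le_sum_prod_pow (Matrix.of (gram K)) r hr htr σ fun _ => 1

lemma eq_zero_of_forall_mul_le_mul_sq {a c : ℝ} (h : ∀ s : ℝ, a * s ≤ c * s ^ 2) : a = 0 := by
  by_contra ha
  have hc := h (a / (|c| + 1))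
  have hpos : 0 < |c| + 1 := by positivity
  have ha2 : 0 < a ^ 2 := by positivity
  rw [div_pow, ← mul_div_assoc, ← mul_div_assoc, div_le_div_iff₀ hpos (by positivity)] at hc
  nlinarith [le_abs_self c, mul_pos ha2 hpos, mul_pos (mul_pos ha2 hpos) hpos, abs_nonneg c,
    mul_nonneg ha2.le (sub_nonneg.2 (le_abs_self c)), mul_pos hpos hpos]

lemma sum_mul_eq_gram {α β : Type*} [Fintype α] [Fintype β] (K : α → β → ℝ) (w w' : β → ℝ) :
    ∑ a, (∑ b, K a b * w b) * (∑ b, K a b * w' b)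
      = ∑ b, w b * ∑ b', gram K b b' * w' b' := by
  simp_rw [gram, Finset.sum_mul, Finset.mul_sum]
  rw [Finset.sum_comm]
  refine Finset.sum_congr rfl fun b _ => ?_
  rw [Finset.sum_comm]
  refine Finset.sum_congr rfl fun b' _ => ?_
  exact Finset.sum_congr rfl fun a _ => by ring

/-- A matrix with nonnegative entries has a nonnegative top right singular vector. -/
lemma exists_perron {α β : Type*} [Fintype α] [Fintype β] [Nonempty β] (K : α → β → ℝ)
    (hK : ∀ a b, 0 ≤ K a b) :
    ∃ (r : ℝ) (v : β → ℝ), (∀ b, 0 ≤ v b) ∧ ∑ b, v b ^ 2 = 1 ∧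
      (∀ b, ∑ b', gram K b b' * v b' = r * v b) ∧
      ∀ w : β → ℝ, ∑ a, (∑ b, K a b * w b) ^ 2 ≤ r * ∑ b, w b ^ 2 := by
  classical
  let q : (β → ℝ) → ℝ := fun w => ∑ a, (∑ b, K a b * w b) ^ 2
  have hcomp : IsCompact {w : β → ℝ | ∑ b, w b ^ 2 = 1} := by
    refine Metric.isCompact_of_isClosed_isBounded
      (isClosed_eq (by fun_prop) continuous_const) ?_
    refine (Metric.isBounded_closedBall (x := (0 : β → ℝ)) (r := 1)).subset fun w hw => ?_
    rw [mem_closedBall_zero_iff, pi_norm_le_iff_of_nonneg zero_le_one]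
    intro b
    rw [Real.norm_eq_abs, ← sq_le_one_iff_abs_le_one]
    exact (Finset.single_le_sum (f := fun b => w b ^ 2) (fun b _ => sq_nonneg _)
      (Finset.mem_univ b)).trans_eq hw
  obtain ⟨w₀, hw₀, hmax⟩ := hcomp.exists_isMaxOn (f := q)
    ⟨Pi.single (Classical.arbitrary β) 1, by
      simp [Pi.single_apply, ite_pow]⟩
    (by fun_prop)
  have hv1 : ∑ b, |w₀ b| ^ 2 = 1 := by simpa using hw₀
  set v : β → ℝ := fun b => |w₀ b| with hv
  -- passing to absolute values does not decrease `q`, so a maximizer may be taken nonnegative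
  have hqv : q v = q w₀ := by
    refine le_antisymm (hmax hv1) (Finset.sum_le_sum fun a _ => ?_)
    rw [← sq_abs (∑ b, K a b * w₀ b)]
    refine pow_le_pow_left₀ (abs_nonneg _) ((Finset.abs_sum_le_sum_abs _ _).trans_eq ?_) 2
    exact Finset.sum_congr rfl fun b _ => by rw [abs_mul, abs_of_nonneg (hK a b)]
  have hhom : ∀ w : β → ℝ, q w ≤ q v * ∑ b, w b ^ 2 := by
    intro w
    rcases (Finset.sum_nonneg fun b (_ : b ∈ Finset.univ) => sq_nonneg (w b)).eq_or_lt with h | h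
    · have hz : ∀ b, w b = 0 := by
        intro b
        have := (Finset.sum_eq_zero_iff_of_nonneg fun b _ => sq_nonneg (w b)).1 h.symm b
          (Finset.mem_univ b)
        simpa using this
      simp [q, hz]
    · set s := ∑ b, w b ^ 2 with hs
      have hm : (fun b => w b / √s) ∈ {w : β → ℝ | ∑ b, w b ^ 2 = 1} := by
        simp only [Set.mem_ofPred_eq, div_pow, Real.sq_sqrt h.le]
        rw [← Finset.sum_div, ← hs, div_self h.ne']
      have := hmax hm
      have hq : q (fun b => w b / √s) = q w / s := by
        simp only [q, ← mul_div_assoc, ← Finset.sum_div, div_pow, Real.sq_sqrt h.le]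
      rw [Set.mem_ofPred_eq, hq, div_le_iff₀ h] at this
      rwa [hqv]
  refine ⟨q v, v, fun b => abs_nonneg _, hv1, fun b => ?_, hhom⟩
  -- the first variation of the Rayleigh quotient at its maximizer vanishes
  have hvar : ∀ s : ℝ, (2 * (∑ b', gram K b b' * v b' - q v * v b)) * s
      ≤ (q v - gram K b b) * s ^ 2 := by
    intro s
    have h := hhom fun b' => v b' + s * (Pi.single b 1 : β → ℝ) b'
    have e1 : q (fun b' => v b' + s * (Pi.single b 1 : β → ℝ) b')
        = q v + 2 * s * ∑ b', gram K b b' * v b' + s ^ 2 * gram K b b := by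
      have e2 := sum_mul_eq_gram K (Pi.single b 1) v
      have e3 := sum_mul_eq_gram K (Pi.single b 1) (Pi.single b 1)
      simp [Pi.single_apply] at e2 e3
      rw [← e2, ← e3]
      simp only [q, Finset.mul_sum, ← Finset.sum_add_distrib]
      refine Finset.sum_congr rfl fun a _ => ?_
      simp [mul_add, Finset.sum_add_distrib, Pi.single_apply]
      simp only [← Finset.mul_sum]
      ring
    have e4 : ∑ b', (v b' + s * (Pi.single b 1 : β → ℝ) b') ^ 2 = 1 + 2 * s * v b + s ^ 2 := by
      simp only [add_sq, Finset.sum_add_distrib, Pi.single_apply]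
      simp only [mul_ite, mul_one, mul_zero, ite_pow, Finset.sum_ite_eq', Finset.mem_univ, if_true,
        ne_eq, OfNat.ofNat_ne_zero, not_false_eq_true, zero_pow]
      rw [show ∑ b, v b ^ 2 = 1 from hv1]
      ring
    rw [e1, e4] at h
    linarith
  linarith [eq_zero_of_forall_mul_le_mul_sq hvar]

/-- The equation `(r - Kᵀ K) h = d v` is solvable if the matrix `d` is antisymmetric and supported
where `Kᵀ K` is: an eigenvector `w` for the eigenvalue `r` is such that `w / v` is constant
along the edges of `Kᵀ K`, and hence orthogonal to `d v`. -/
lemma exists_poisson_solution {α β : Type*} [Fintype α] [Fintype β] (K : α → β → ℝ)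
    (hK : ∀ a b, 0 ≤ K a b) (r : ℝ) (v : β → ℝ) (hv : ∀ b, 0 < v b)
    (heig : ∀ b, ∑ b', gram K b b' * v b' = r * v b) (d : β → β → ℝ)
    (hd : ∀ b b', d b b' = -d b' b) (hsupp : ∀ b b', gram K b b' = 0 → d b b' = 0) :
    ∃ h : β → ℝ, ∀ b, r * h b - ∑ b', gram K b b' * h b' = ∑ b', d b b' * v b' := by
  classical
  let T : (β → ℝ) →ₗ[ℝ] (β → ℝ) :=
    { toFun := fun h b => r * h b - ∑ b', gram K b b' * h b'
      map_add' := fun h h' => by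
        ext b; simp only [Pi.add_apply, mul_add, Finset.sum_add_distrib]; ring
      map_smul' := fun c h => by
        ext b
        simp only [Pi.smul_apply, smul_eq_mul, RingHom.id_apply, mul_sub, Finset.mul_sum]
        congr 1
        · ring
        · exact Finset.sum_congr rfl fun b' _ => by ring }
  suffices h : (fun b => ∑ b', d b b' * v b') ∈ LinearMap.range T by
    obtain ⟨h, hh⟩ := h
    exact ⟨h, fun b => congrFun hh b⟩
  by_contra hcon
  obtain ⟨f, hf, hker⟩ := Submodule.exists_le_ker_of_notMem hcon
  set w : β → ℝ := fun b => f (Pi.single b 1) with hw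
  have hfw : ∀ g : β → ℝ, f g = ∑ b, w b * g b := by
    intro g
    conv_lhs => rw [← Finset.univ_sum_single g]
    rw [map_sum]
    refine Finset.sum_congr rfl fun b _ => ?_
    have : (Pi.single b (g b) : β → ℝ) = g b • Pi.single b 1 := by
      rw [← Pi.single_smul]; simp
    rw [this, map_smul, smul_eq_mul, mul_comm]
  have hweig : ∀ b, ∑ b', gram K b b' * w b' = r * w b := by
    intro b
    have h0 : f (T (Pi.single b 1)) = 0 := hker ⟨_, rfl⟩
    rw [hfw] at h0
    simp only [T, LinearMap.coe_mk, AddHom.coe_mk, mul_sub, Finset.sum_sub_distrib] at h0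
    simp [Pi.single_apply] at h0
    rw [sub_eq_zero] at h0
    rw [mul_comm, h0]
    exact Finset.sum_congr rfl fun b' _ => by rw [gram_comm, mul_comm]
  -- the Dirichlet form of `w / v` vanishes
  have hdir : ∑ b, ∑ b', gram K b b' * v b * v b' * (w b / v b - w b' / v b') ^ 2 = 0 := by
    have e : ∀ b b', gram K b b' * v b * v b' * (w b / v b - w b' / v b') ^ 2
        = w b ^ 2 / v b * (gram K b b' * v b') + w b' ^ 2 / v b' * (gram K b' b * v b)
          - 2 * (w b * (gram K b b' * w b')) := by
      intro b b'
      rw [gram_comm K b' b]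
      have := (hv b).ne'
      have := (hv b').ne'
      field_simp
      ring
    simp only [e, Finset.sum_sub_distrib, Finset.sum_add_distrib]
    rw [Finset.sum_comm (f := fun b b' => w b' ^ 2 / v b' * (gram K b' b * v b))]
    simp only [← Finset.mul_sum, heig, hweig]
    have : ∀ b, w b ^ 2 / v b * (r * v b) = w b * (r * w b) := fun b => by
      have := (hv b).ne'
      field_simp
    simp only [this]
    ring
  have hconst : ∀ b b', gram K b b' ≠ 0 → w b / v b = w b' / v b' := by
    intro b b' hne
    have hnn : ∀ b b', 0 ≤ gram K b b' * v b * v b' * (w b / v b - w b' / v b') ^ 2 :=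
      fun b b' => mul_nonneg (mul_nonneg (mul_nonneg (gram_nonneg hK _ _) (hv b).le) (hv b').le)
        (sq_nonneg _)
    have h1 := (Finset.sum_eq_zero_iff_of_nonneg
      fun b _ => Finset.sum_nonneg fun b' _ => hnn b b').1 hdir b (Finset.mem_univ b)
    have h2 := (Finset.sum_eq_zero_iff_of_nonneg fun b' _ => hnn b b').1 h1 b' (Finset.mem_univ b')
    have h3 := (mul_eq_zero.1 h2).resolve_left
      (mul_ne_zero (mul_ne_zero hne (hv b).ne') (hv b').ne')
    exact sub_eq_zero.1 ((pow_eq_zero_iff two_ne_zero).1 h3)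
  apply hf
  rw [hfw]
  have hs : ∑ b, w b * ∑ b', d b b' * v b' = ∑ b, ∑ b', w b / v b * (v b * d b b' * v b') := by
    refine Finset.sum_congr rfl fun b _ => ?_
    rw [Finset.mul_sum]
    refine Finset.sum_congr rfl fun b' _ => ?_
    have := (hv b).ne'
    field_simp
  have hanti : ∑ b, ∑ b', w b / v b * (v b * d b b' * v b')
      = -∑ b, ∑ b', w b / v b * (v b * d b b' * v b') := by
    conv_rhs => rw [Finset.sum_comm]
    simp only [← Finset.sum_neg_distrib]
    refine Finset.sum_congr rfl fun b _ => Finset.sum_congr rfl fun b' _ => ?_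
    by_cases h0 : gram K b b' = 0
    · rw [hsupp _ _ h0, hsupp b' b (by rwa [gram_comm])]; simp
    · rw [hconst b b' h0, hd b b']; ring
  linarith

/-! ### Exponential tilting and the lower bound -/

/-- The Gram matrix of `K`, exponentially tilted by the antisymmetric increments of `θ`. -/
noncomputable def tiltedGram {α β : Type*} [Fintype α] (K θ : α → β → ℝ) (t : ℝ) (b b' : β) : ℝ :=
  ∑ a, K a b * K a b' * Real.exp (t * (θ a b - θ a b'))

/-- To first order in `t` the tilt does not move the top eigenvalue: the Poisson equation provides
a perturbation `v + t h` of the eigenvector `v` that absorbs the first-order term. -/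
lemma exists_tilted_superEigenvector {α β : Type*} [Fintype α] [Fintype β] (K θ : α → β → ℝ)
    (hK : ∀ a b, 0 ≤ K a b) (r : ℝ) (hr : 0 < r) (v : β → ℝ) (hv : ∀ b, 0 < v b)
    (heig : ∀ b, ∑ b', gram K b b' * v b' = r * v b) (η : ℝ) (hη : 0 < η) :
    ∃ t > 0, ∀ s : ℝ, |s| = t → ∃ g : β → ℝ, (∀ b, 0 < g b) ∧
      ∀ b, ∑ b', tiltedGram K θ s b b' * g b' ≤ r * Real.exp (η * t) * g b := by
  have hsupp : ∀ b b', gram K b b' = 0 → ∑ a, K a b * K a b' * (θ a b - θ a b') = 0 := by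
    intro b b' h0
    have := (Finset.sum_eq_zero_iff_of_nonneg
      fun a _ => mul_nonneg (hK a b) (hK a b')).1 h0
    exact Finset.sum_eq_zero fun a ha => by rw [this a ha, zero_mul]
  obtain ⟨h, hh⟩ := exists_poisson_solution K hK r v hv heig
    (fun b b' => ∑ a, K a b * K a b' * (θ a b - θ a b'))
    (fun b b' => by
      rw [← Finset.sum_neg_distrib]
      exact Finset.sum_congr rfl fun a _ => by ring) hsupp
  have hder : ∀ b, HasDerivAt (fun s => ∑ b', tiltedGram K θ s b b' * (v b' + s * h b')
      - r * (v b + s * h b)) 0 0 := by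
    intro b
    have h1 : ∀ b', HasDerivAt (fun s => tiltedGram K θ s b b')
        (∑ a, K a b * K a b' * (θ a b - θ a b')) 0 := by
      intro b'
      refine HasDerivAt.fun_sum fun a _ => ?_
      have := (((hasDerivAt_id (0 : ℝ)).mul_const (θ a b - θ a b')).exp).const_mul (K a b * K a b')
      simpa using this
    have h2 : ∀ b', HasDerivAt (fun s : ℝ => v b' + s * h b') (h b') 0 := by
      intro b'
      simpa using ((hasDerivAt_id (0 : ℝ)).mul_const (h b')).const_add (v b')
    have h3 := (HasDerivAt.fun_sum fun b' (_ : b' ∈ Finset.univ) => (h1 b').mul (h2 b')).sub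
      ((h2 b).const_mul r)
    refine h3.congr_deriv ?_
    have h4 : ∀ b', tiltedGram K θ 0 b b' = gram K b b' := fun b' => by
      simp [tiltedGram, gram]
    simp only [h4, zero_mul, add_zero, Finset.sum_add_distrib]
    linarith [hh b]
  have hzero : ∀ b, ∑ b', tiltedGram K θ 0 b b' * (v b' + 0 * h b') - r * (v b + 0 * h b) = 0 := by
    intro b
    have h4 : ∀ b', tiltedGram K θ 0 b b' = gram K b b' := fun b' => by
      simp [tiltedGram, gram]
    simp only [h4, zero_mul, add_zero, heig, sub_self]
  have hev : ∀ᶠ s in 𝓝 (0 : ℝ), ∀ b, v b / 2 ≤ v b + s * h b ∧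
      ∑ b', tiltedGram K θ s b b' * (v b' + s * h b') - r * (v b + s * h b)
        ≤ r * η * (v b / 2) * |s| := by
    refine eventually_all.2 fun b => ?_
    have hc : Continuous fun s : ℝ => v b + s * h b := by fun_prop
    have e1 := hc.continuousAt (x := 0) |>.eventually_const_lt
      (show v b / 2 < v b + 0 * h b by linarith [hv b])
    have e2 := (hasDerivAt_iff_isLittleO.1 (hder b)).def
      (show 0 < r * η * (v b / 2) by have := hv b; positivity)
    filter_upwards [e1, e2] with s hs1 hs2
    refine ⟨hs1.le, ?_⟩
    rw [hzero b] at hs2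
    simp only [sub_zero, smul_zero, Real.norm_eq_abs] at hs2
    exact (le_abs_self _).trans hs2
  obtain ⟨δ, hδ, hball⟩ := Metric.eventually_nhds_iff.1 hev
  refine ⟨δ / 2, by positivity, fun s hs => ⟨fun b => v b + s * h b, fun b => ?_, fun b => ?_⟩⟩
  all_goals
    obtain ⟨h1, h2⟩ := @hball s (by rw [Real.dist_eq, sub_zero, hs]; linarith) b
    have hvb := hv b
  · linarith
  · rw [hs] at h2
    have h3 : η * (δ / 2) + 1 ≤ Real.exp (η * (δ / 2)) := Real.add_one_le_exp _
    have h4 : r * η * (v b / 2) * (δ / 2) ≤ r * (v b + s * h b) * (η * (δ / 2)) := by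
      have : r * η * (δ / 2) * (v b / 2) ≤ r * η * (δ / 2) * (v b + s * h b) :=
        mul_le_mul_of_nonneg_left h1 (by positivity)
      linarith
    have h5 : r * (v b + s * h b) * (η * (δ / 2) + 1)
        ≤ r * (v b + s * h b) * Real.exp (η * (δ / 2)) :=
      mul_le_mul_of_nonneg_left h3 (mul_nonneg hr.le (by linarith))
    linarith

lemma permSum_sum {α β : Type*} [Fintype α] [Fintype β] {n : ℕ} (σ : Equiv.Perm (Fin n))
    (f : α → β → β → ℝ) :
    permSum σ (fun b b' => ∑ a, f a b b')
      = ∑ x : Fin n → α, ∑ y : Fin n → β, ∏ i, f (x i) (y i) (y (σ i)) := by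
  classical
  rw [permSum, Finset.sum_comm]
  refine Finset.sum_congr rfl fun y _ => ?_
  rw [Finset.prod_univ_sum, Fintype.piFinset_univ]

/-- Under the weight `∏ i, K (x i) (y i) * K (x i) (y (σ i))` the increment
`∑ i, (θ (x i) (y i) - θ (x i) (y (σ i)))` is typically `o(n)`, by exponential tilting. -/
lemma exists_le_sum_small_increment {α β : Type*} [Fintype α] [Fintype β] [Nonempty β]
    (K θ : α → β → ℝ)
    (hK : ∀ a b, 0 ≤ K a b) (r : ℝ) (hr : 0 < r) (v : β → ℝ) (hv : ∀ b, 0 < v b)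
    (hv1 : ∑ b, v b ^ 2 = 1)
    (heig : ∀ b, ∑ b', gram K b b' * v b' = r * v b) (ε : ℝ) (hε : 0 < ε) :
    ∃ t > 0, ∀ (n : ℕ) (σ : Equiv.Perm (Fin n)) (R : Finset (Fin n)),
      (∀ i, ∃ k : ℕ, (σ ^ k) i ∈ R) →
      r ^ n * (1 - 2 * (Real.exp (-(t * n)) * (Fintype.card β : ℝ) ^ R.card)) ≤
        ∑ x : Fin n → α, ∑ y : Fin n → β,
          if |∑ i, (θ (x i) (y i) - θ (x i) (y (σ i)))| ≤ ε * n then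
            ∏ i, (K (x i) (y i) * K (x i) (y (σ i))) else 0 := by
  obtain ⟨t, ht, hsup⟩ := exists_tilted_superEigenvector K θ hK r hr v hv heig (ε / 2)
    (by positivity)
  refine ⟨t * (ε / 2), by positivity, fun n σ R hR => ?_⟩
  have htail : ∀ s, |s| = t → permSum σ (tiltedGram K θ s) * Real.exp (-(t * (ε * n)))
      ≤ r ^ n * (Real.exp (-(t * (ε / 2) * n)) * (Fintype.card β : ℝ) ^ R.card) := by
    intro s hs
    obtain ⟨g, hg, hrow⟩ := hsup s hs
    have hnn : ∀ b b', 0 ≤ tiltedGram K θ s b b' := fun b b' =>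
      Finset.sum_nonneg fun a _ => mul_nonneg (mul_nonneg (hK _ _) (hK _ _)) (Real.exp_pos _).le
    have := permSum_le_of_superEigenvector σ _ hnn g hg _ (by positivity) hrow R hR
    refine (mul_le_mul_of_nonneg_right this (Real.exp_pos _).le).trans_eq ?_
    rw [mul_pow, ← Real.exp_nat_mul]
    have : Real.exp (-(t * (ε / 2) * n))
        = Real.exp (n * (ε / 2 * t)) * Real.exp (-(t * (ε * n))) := by
      rw [← Real.exp_add]; congr 1; ring
    rw [this]
    ring
  have htilt : ∀ s, permSum σ (tiltedGram K θ s) = ∑ x : Fin n → α, ∑ y : Fin n → β,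
      (∏ i, (K (x i) (y i) * K (x i) (y (σ i)))) *
        Real.exp (s * ∑ i, (θ (x i) (y i) - θ (x i) (y (σ i)))) := by
    intro s
    refine (permSum_sum σ _).trans (Finset.sum_congr rfl fun x _ => Finset.sum_congr rfl
      fun y _ => ?_)
    rw [Finset.prod_mul_distrib, Finset.mul_sum, Real.exp_sum]
  have hlow := pow_le_permSum_gram K r hr.le v hv1 heig σ
  have hgram : permSum σ (gram K) = ∑ x : Fin n → α, ∑ y : Fin n → β,
      ∏ i, (K (x i) (y i) * K (x i) (y (σ i))) := permSum_sum σ _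
  -- the images with a large increment of either sign are dominated by one of the tilts `t`, `-t`
  have hpt : permSum σ (gram K) ≤ (∑ x : Fin n → α, ∑ y : Fin n → β,
          if |∑ i, (θ (x i) (y i) - θ (x i) (y (σ i)))| ≤ ε * n then
            ∏ i, (K (x i) (y i) * K (x i) (y (σ i))) else 0)
        + permSum σ (tiltedGram K θ t) * Real.exp (-(t * (ε * n)))
        + permSum σ (tiltedGram K θ (-t)) * Real.exp (-(t * (ε * n))) := by
    rw [hgram, htilt, htilt]
    simp only [Finset.sum_mul, ← Finset.sum_add_distrib]
    refine Finset.sum_le_sum fun x _ => Finset.sum_le_sum fun y _ => ?_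
    set w := ∏ i, (K (x i) (y i) * K (x i) (y (σ i)))
    set D := ∑ i, (θ (x i) (y i) - θ (x i) (y (σ i)))
    have hw : 0 ≤ w := Finset.prod_nonneg fun i _ => mul_nonneg (hK _ _) (hK _ _)
    have hp : ∀ z, 0 ≤ w * Real.exp z * Real.exp (-(t * (ε * n))) := fun z => by positivity
    split_ifs with hD
    · linarith [hp (t * D), hp (-t * D)]
    · have hbig : ∀ z, t * (ε * n) ≤ z → w ≤ w * Real.exp z * Real.exp (-(t * (ε * n))) := by
        intro z hz
        rw [mul_assoc, ← Real.exp_add]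
        exact le_mul_of_one_le_right hw (Real.one_le_exp (by linarith))
      rcases lt_abs.1 (not_le.1 hD) with h | h
      · linarith [hbig (t * D) (mul_le_mul_of_nonneg_left h.le ht.le), hp (-t * D)]
      · linarith [hbig (-t * D) (by
          rw [neg_mul_comm]; exact mul_le_mul_of_nonneg_left h.le ht.le), hp (t * D)]
  have h1 := htail t (abs_of_pos ht)
  have h2 := htail (-t) (by rw [abs_neg, abs_of_pos ht])
  linarith

/-- The minimum of two likelihoods is at least their geometric mean, up to the exponential of half
the absolute log-likelihood ratio. -/
lemma le_min_likelihood {𝒳 𝒴 : Type*} (P : 𝒳 → ℝ) (hP : ∀ a, 0 ≤ P a) (W : 𝒳 → 𝒴 → ℝ)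
    (hW : ∀ a b, 0 ≤ W a b) {n : ℕ} (σ : Equiv.Perm (Fin n)) (x : Fin n → 𝒳) (y : Fin n → 𝒴)
    (c : ℝ) (hc : |∑ i, (Real.log (W (x i) (y i)) - Real.log (W (x i) (y (σ i))))| ≤ c) :
    Real.exp (-(c / 2)) * ∏ i, (√(P (x i) * W (x i) (y i)) * √(P (x i) * W (x i) (y (σ i)))) ≤
      (∏ i, P (x i)) * min (likelihood W x y) (likelihood W x (transform σ y)) := by
  by_cases h0 : ∃ i, √(P (x i) * W (x i) (y i)) * √(P (x i) * W (x i) (y (σ i))) = 0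
  · obtain ⟨i, hi⟩ := h0
    rw [Finset.prod_eq_zero (Finset.mem_univ i) hi, mul_zero]
    exact mul_nonneg (Finset.prod_nonneg fun i _ => hP _)
      (le_min (Finset.prod_nonneg fun i _ => hW _ _) (Finset.prod_nonneg fun i _ => hW _ _))
  · push Not at h0
    have hpos : ∀ i, 0 < W (x i) (y i) ∧ 0 < W (x i) (y (σ i)) := by
      intro i
      refine ⟨(hW _ _).lt_of_ne' fun h => h0 i ?_, (hW _ _).lt_of_ne' fun h => h0 i ?_⟩ <;>
        simp [h]
    have e1 : ∀ i, √(P (x i) * W (x i) (y i)) * √(P (x i) * W (x i) (y (σ i)))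
        = P (x i) * Real.exp ((Real.log (W (x i) (y i)) + Real.log (W (x i) (y (σ i)))) / 2) := by
      intro i
      rw [Real.sqrt_mul (hP _), Real.sqrt_mul (hP _), add_div, Real.exp_add, Real.exp_half,
        Real.exp_half, Real.exp_log (hpos i).1, Real.exp_log (hpos i).2, mul_mul_mul_comm,
        Real.mul_self_sqrt (hP _)]
    have e2 : likelihood W x y = Real.exp (∑ i, Real.log (W (x i) (y i))) := by
      rw [Real.exp_sum]
      exact Finset.prod_congr rfl fun i _ => (Real.exp_log (hpos i).1).symm
    have e3 : likelihood W x (transform σ y) = Real.exp (∑ i, Real.log (W (x i) (y (σ i)))) := by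
      rw [Real.exp_sum]
      exact Finset.prod_congr rfl fun i _ => (Real.exp_log (hpos i).2).symm
    simp only [e1]
    rw [Finset.prod_mul_distrib, mul_left_comm, e2, e3, ← Real.exp_sum, ← Real.exp_add]
    refine mul_le_mul_of_nonneg_left ?_ (Finset.prod_nonneg fun i _ => hP _)
    rw [← Finset.sum_div, Finset.sum_add_distrib]
    rw [Finset.sum_sub_distrib] at hc
    have := abs_le.1 hc
    exact le_min (Real.exp_le_exp.2 (by linarith)) (Real.exp_le_exp.2 (by linarith))

/-- Lower bound for the probability of confusing `1` with `σ`, for an arbitrary decision. Only the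
images with pixels in the support of the top eigenvector `v` are used. -/
lemma exists_le_sum_min_likelihood {𝒳 𝒴 : Type*} [Fintype 𝒳] [Fintype 𝒴] (P : 𝒳 → ℝ)
    (hP : ∀ a, 0 ≤ P a) (W : 𝒳 → 𝒴 → ℝ) (hW : ∀ a b, 0 ≤ W a b) (r : ℝ) (hr : 0 < r)
    (v : 𝒴 → ℝ) (hv : ∀ b, 0 ≤ v b) (hv1 : ∑ b, v b ^ 2 = 1)
    (heig : ∀ b, ∑ b', gram (fun a b => √(P a * W a b)) b b' * v b' = r * v b)
    (ε : ℝ) (hε : 0 < ε) :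
    ∃ t > 0, ∀ (n : ℕ) (σ : Equiv.Perm (Fin n)) (R : Finset (Fin n)),
      (∀ i, ∃ k : ℕ, (σ ^ k) i ∈ R) →
      Real.exp (-(ε * n)) * (r ^ n *
        (1 - 2 * (Real.exp (-(t * n)) * (Fintype.card 𝒴 : ℝ) ^ R.card))) ≤
        ∑ x : Fin n → 𝒳, ∑ y : Fin n → 𝒴,
          (∏ i, P (x i)) * min (likelihood W x y) (likelihood W x (transform σ y)) := by
  classical
  let β := {b : 𝒴 // 0 < v b}
  have hsub : ∀ f : 𝒴 → ℝ, (∀ b, v b = 0 → f b = 0) → ∑ b : β, f b = ∑ b, f b := by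
    intro f hf
    rw [← Finset.sum_subtype (Finset.univ.filter fun b => 0 < v b) (by simp) f]
    exact Finset.sum_filter_of_ne fun b _ h => (hv b).lt_of_ne' fun hb => h (hf b hb)
  have hv1' : ∑ b : β, v b ^ 2 = 1 := by
    rw [← hv1]; exact hsub (fun b => v b ^ 2) fun b hb => by simp [hb]
  have : Nonempty β := by
    by_contra hne
    rw [not_nonempty_iff] at hne
    simp at hv1'
  obtain ⟨t, ht, hlow⟩ := exists_le_sum_small_increment
    (fun a (b : β) => √(P a * W a b)) (fun a (b : β) => Real.log (W a b))
    (fun a b => Real.sqrt_nonneg _) r hr (fun b => v b) (fun b => b.2) hv1'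
    (fun b => by
      rw [← heig b]
      exact hsub (fun b' => gram (fun a b => √(P a * W a b)) b b' * v b') fun b' hb => by simp [hb])
    (2 * ε) (by positivity)
  refine ⟨t, ht, fun n σ R hR => ?_⟩
  have hcard : (Fintype.card β : ℝ) ^ R.card ≤ (Fintype.card 𝒴 : ℝ) ^ R.card :=
    pow_le_pow_left₀ (by positivity) (by exact_mod_cast Fintype.card_subtype_le _) _
  have h1 : r ^ n * (1 - 2 * (Real.exp (-(t * n)) * (Fintype.card 𝒴 : ℝ) ^ R.card)) ≤
      r ^ n * (1 - 2 * (Real.exp (-(t * n)) * (Fintype.card β : ℝ) ^ R.card)) := by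
    have := mul_le_mul_of_nonneg_left hcard (Real.exp_pos (-(t * n))).le
    exact mul_le_mul_of_nonneg_left (by linarith) (by positivity)
  refine (mul_le_mul_of_nonneg_left (h1.trans (hlow n σ R hR)) (Real.exp_pos _).le).trans ?_
  have hnn : ∀ (x : Fin n → 𝒳) (y : Fin n → 𝒴), 0 ≤
      (∏ i, P (x i)) * min (likelihood W x y) (likelihood W x (transform σ y)) := fun x y =>
    mul_nonneg (Finset.prod_nonneg fun i _ => hP _)
      (le_min (Finset.prod_nonneg fun i _ => hW _ _) (Finset.prod_nonneg fun i _ => hW _ _))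
  rw [Finset.mul_sum]
  refine Finset.sum_le_sum fun x _ => ?_
  have hinj : Function.Injective fun (y : Fin n → β) i => (y i : 𝒴) := fun y y' h =>
    funext fun i => Subtype.ext (congrFun h i)
  refine le_trans ?_ (Finset.sum_le_sum_of_subset_of_nonneg
    (Finset.subset_univ (Finset.univ.image fun (y : Fin n → β) i => (y i : 𝒴)))
    fun y _ _ => hnn x y)
  rw [Finset.sum_image fun y _ y' _ h => hinj h, Finset.mul_sum]
  refine Finset.sum_le_sum fun y _ => ?_
  split_ifs with hD
  · have := le_min_likelihood P hP W hW σ x (fun i => (y i : 𝒴)) _ hD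
    rw [show -(ε * n) = -(2 * ε * n / 2) by ring]
    exact this
  · rw [mul_zero]; exact hnn _ _

/-! ### Joint types and the upper bound for maximum mutual information -/

lemma sum_sum_empiricalDist_mul {𝒳 𝒴 : Type*} [Fintype 𝒳] [Fintype 𝒴] {n : ℕ} (x : Fin n → 𝒳)
    (y : Fin n → 𝒴) (f : 𝒳 → 𝒴 → ℝ) :
    ∑ a, ∑ b, empiricalDist x y a b * f a b = (1 / (n : ℝ)) * ∑ i, f (x i) (y i) := by
  classical
  simp only [empiricalDist, mul_assoc, ← Finset.mul_sum, Finset.sum_mul]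
  congr 1
  simp_rw [Finset.sum_comm (s := (Finset.univ : Finset 𝒴))]
  rw [Finset.sum_comm]
  refine Finset.sum_congr rfl fun i _ => ?_
  simp only [ite_and, ite_mul, one_mul, zero_mul]
  simp

lemma empiricalDist_nonneg {𝒳 𝒴 : Type*} {n : ℕ} (x : Fin n → 𝒳)
    (y : Fin n → 𝒴) (a : 𝒳) (b : 𝒴) : 0 ≤ empiricalDist x y a b :=
  mul_nonneg (by positivity) (Finset.sum_nonneg fun i _ => by split_ifs <;> norm_num)

lemma empiricalDist_pos_iff {𝒳 𝒴 : Type*} {n : ℕ} (x : Fin n → 𝒳)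
    (y : Fin n → 𝒴) (a : 𝒳) (b : 𝒴) :
    0 < empiricalDist x y a b ↔ ∃ i, x i = a ∧ y i = b := by
  classical
  constructor
  · intro h
    by_contra! hcon
    have : empiricalDist x y a b = 0 := by
      rw [empiricalDist, Finset.sum_eq_zero, mul_zero]
      exact fun i _ => if_neg fun hi => hcon i hi.1 hi.2
    exact h.ne' this
  · rintro ⟨i, hi⟩
    have hn : 0 < n := i.pos
    refine mul_pos (by positivity) (Finset.sum_pos' (fun i _ => by split_ifs <;> norm_num)
      ⟨i, Finset.mem_univ i, ?_⟩)
    rw [if_pos hi]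
    exact one_pos

lemma sum_empiricalDist_transform {𝒳 𝒴 : Type*} [Fintype 𝒳] {n : ℕ} (x : Fin n → 𝒳)
    (y : Fin n → 𝒴) (σ : Equiv.Perm (Fin n)) (b : 𝒴) :
    ∑ a, empiricalDist x (transform σ y) a b = ∑ a, empiricalDist x y a b := by
  classical
  have h : ∀ y : Fin n → 𝒴, ∑ a, empiricalDist x y a b
      = (1 / (n : ℝ)) * ∑ i, if y i = b then 1 else 0 := by
    intro y
    simp only [empiricalDist, ← Finset.mul_sum]
    rw [Finset.sum_comm]
    simp [ite_and]
  rw [h, h, ← Equiv.sum_comp σ fun i => if y i = b then (1 : ℝ) else 0]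
  rfl

/-- Gibbs' inequality, in the form `D(q ‖ K²) + I(q) ≥ -log r`, where `r` is the squared norm of
`K`. -/
lemma sum_mul_log_le {α β : Type*} [Fintype α] [Fintype β] (K : α → β → ℝ)
    (hK : ∀ a b, 0 ≤ K a b) (r : ℝ) (hr : 0 < r)
    (hnorm : ∀ w : β → ℝ, ∑ a, (∑ b, K a b * w b) ^ 2 ≤ r * ∑ b, w b ^ 2)
    (q : α → β → ℝ) (hq : ∀ a b, 0 ≤ q a b) (hq1 : ∑ a, ∑ b, q a b = 1)
    (hsupp : ∀ a b, 0 < q a b → 0 < K a b) :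
    ∑ a, ∑ b, q a b * Real.log (K a b ^ 2) ≤ Real.log r
      + ∑ a, ∑ b, q a b * Real.log (q a b / ∑ a', q a' b)
      + ∑ a, ∑ b, q a b * Real.log (q a b / ((∑ b', q a b') * ∑ a', q a' b))
      + ∑ a, ∑ b, q a b * Real.log (∑ a', q a' b) := by
  set qX : α → ℝ := fun a => ∑ b', q a b' with hqX
  set qY : β → ℝ := fun b => ∑ a', q a' b with hqY
  have hX : ∀ a, 0 ≤ qX a := fun a => Finset.sum_nonneg fun b _ => hq a b
  have hY : ∀ b, 0 ≤ qY b := fun b => Finset.sum_nonneg fun a _ => hq a b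
  have hterm : ∀ a b, q a b * Real.log (K a b ^ 2) - q a b * Real.log r
      - q a b * Real.log (q a b / qY b) - q a b * Real.log (q a b / (qX a * qY b))
      - q a b * Real.log (qY b) ≤ 2 * (√(qX a) * (K a b * √(qY b)) / √r) - 2 * q a b := by
    intro a b
    rcases (hq a b).eq_or_lt with h0 | hpos
    · rw [← h0]
      have : 0 ≤ √(qX a) * (K a b * √(qY b)) / √r :=
        div_nonneg (mul_nonneg (Real.sqrt_nonneg _) (mul_nonneg (hK _ _) (Real.sqrt_nonneg _)))
          (Real.sqrt_nonneg _)
      linarith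
    · have hKp := hsupp a b hpos
      have hXp : 0 < qX a := hpos.trans_le
        (Finset.single_le_sum (f := fun b => q a b) (fun b _ => hq a b) (Finset.mem_univ b))
      have hYp : 0 < qY b := hpos.trans_le
        (Finset.single_le_sum (f := fun a => q a b) (fun a _ => hq a b) (Finset.mem_univ a))
      have hsX := Real.sqrt_pos.2 hXp
      have hsY := Real.sqrt_pos.2 hYp
      have hsr := Real.sqrt_pos.2 hr
      have hlog := Real.log_le_sub_one_of_pos
        (show 0 < √(qX a) * (K a b * √(qY b)) / √r / q a b by positivity)
      have hmul := mul_le_mul_of_nonneg_left hlog hpos.le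
      rw [mul_sub, mul_div_cancel₀ _ hpos.ne'] at hmul
      rw [Real.log_div (by positivity) hpos.ne', Real.log_div (by positivity) hsr.ne',
        Real.log_mul hsX.ne' (by positivity), Real.log_mul hKp.ne' hsY.ne', Real.log_sqrt hXp.le,
        Real.log_sqrt hYp.le, Real.log_sqrt hr.le] at hmul
      rw [Real.log_pow, Real.log_div hpos.ne' hYp.ne', Real.log_div hpos.ne' (by positivity),
        Real.log_mul hXp.ne' hYp.ne']
      push_cast
      linarith
  have hsum := Finset.sum_le_sum fun a (_ : a ∈ Finset.univ) =>
    Finset.sum_le_sum fun b (_ : b ∈ Finset.univ) => hterm a b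
  simp only [Finset.sum_sub_distrib, ← Finset.sum_mul, ← Finset.mul_sum, ← Finset.sum_div]
    at hsum
  have hq1' : ∑ a, ∑ b, q a b = 1 := hq1
  rw [hq1'] at hsum
  have hXsum : ∑ a, √(qX a) ^ 2 = 1 := by
    simp only [Real.sq_sqrt (hX _)]; exact hq1
  have hYsum : ∑ b, √(qY b) ^ 2 = 1 := by
    simp only [Real.sq_sqrt (hY _)]
    rw [← hq1, Finset.sum_comm]
  have hcs : ∑ a, √(qX a) * ∑ b, K a b * √(qY b) ≤ √r := by
    refine Real.le_sqrt_of_sq_le ((Finset.sum_mul_sq_le_sq_mul_sq _ _ _).trans ?_)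
    rw [hXsum, one_mul]
    simpa [hYsum] using hnorm fun b => √(qY b)
  have hcs' := (div_le_one (Real.sqrt_pos.2 hr)).2 hcs
  change _ ≤ Real.log r + ∑ a, ∑ b, q a b * Real.log (q a b / qY b)
    + ∑ a, ∑ b, q a b * Real.log (q a b / (qX a * qY b)) + ∑ a, ∑ b, q a b * Real.log (qY b)
  linarith

/-- The pointwise estimate behind the maximum mutual information rule: if the empirical mutual
information of `x` and `y` does not exceed that of `x` and `y_σ`, the probability of `(x, y)` is
bounded by `r ^ n` times a product of empirical conditional probabilities along the cycles of
`σ`. -/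
lemma prob_le_of_empiricalMI_le {𝒳 𝒴 : Type*} [Fintype 𝒳] [Fintype 𝒴] (P : 𝒳 → ℝ)
    (hP : ∀ a, 0 ≤ P a) (W : 𝒳 → 𝒴 → ℝ) (hW : ∀ a b, 0 ≤ W a b) (r : ℝ) (hr : 0 < r)
    (hnorm : ∀ w : 𝒴 → ℝ, ∑ a, (∑ b, √(P a * W a b) * w b) ^ 2 ≤ r * ∑ b, w b ^ 2)
    {n : ℕ} (σ : Equiv.Perm (Fin n)) (x : Fin n → 𝒳) (y : Fin n → 𝒴)
    (hMI : empiricalMI x y ≤ empiricalMI x (transform σ y)) :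
    (∏ i, P (x i)) * likelihood W x y ≤ r ^ n * ∏ i,
      (empiricalDist x y (x i) (y i) / (∑ a, empiricalDist x y a (y i)) *
        (empiricalDist x (transform σ y) (x i) (y (σ i)) /
          ∑ b, empiricalDist x (transform σ y) (x i) b)) := by
  set q := empiricalDist x y with hq
  set q' := empiricalDist x (transform σ y) with hq'
  have hqn : ∀ a b, 0 ≤ q a b := empiricalDist_nonneg x y
  have hqn' : ∀ a b, 0 ≤ q' a b := empiricalDist_nonneg x _
  rcases Nat.eq_zero_or_pos n with rfl | hn
  · simp [likelihood]
  have hn' : (0 : ℝ) < n := by exact_mod_cast hn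
  rw [likelihood, ← Finset.prod_mul_distrib]
  by_cases h0 : ∃ i, P (x i) * W (x i) (y i) = 0
  · obtain ⟨i, hi⟩ := h0
    rw [Finset.prod_eq_zero (Finset.mem_univ i) hi]
    refine mul_nonneg (by positivity) (Finset.prod_nonneg fun i _ => mul_nonneg ?_ ?_)
    · exact div_nonneg (hqn _ _) (Finset.sum_nonneg fun _ _ => hqn _ _)
    · exact div_nonneg (hqn' _ _) (Finset.sum_nonneg fun _ _ => hqn' _ _)
  push Not at h0
  have hPW : ∀ i, 0 < P (x i) * W (x i) (y i) := fun i =>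
    (mul_nonneg (hP _) (hW _ _)).lt_of_ne' (h0 i)
  have hqpos : ∀ i, 0 < q (x i) (y i) := fun i =>
    (empiricalDist_pos_iff x y _ _).2 ⟨i, rfl, rfl⟩
  have hqpos' : ∀ i, 0 < q' (x i) (y (σ i)) := fun i =>
    (empiricalDist_pos_iff x _ _ _).2 ⟨i, rfl, rfl⟩
  have hcond : ∀ i, 0 < q (x i) (y i) / ∑ a, q a (y i) := fun i =>
    div_pos (hqpos i) ((hqpos i).trans_le (Finset.single_le_sum (f := fun a => q a (y i))
      (fun _ _ => hqn _ _) (Finset.mem_univ (x i))))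
  have hcond' : ∀ i, 0 < q' (x i) (y (σ i)) / ∑ b, q' (x i) b := fun i =>
    div_pos (hqpos' i) ((hqpos' i).trans_le (Finset.single_le_sum (f := fun b => q' (x i) b)
      (fun _ _ => hqn' _ _) (Finset.mem_univ (y (σ i)))))
  -- it suffices to compare the logarithms, divided by `n`
  rw [← Real.log_le_log_iff (Finset.prod_pos fun i _ => hPW i)
    (mul_pos (by positivity) (Finset.prod_pos fun i _ => mul_pos (hcond i) (hcond' i))),
    Real.log_mul (by positivity)
      (Finset.prod_pos fun i _ => mul_pos (hcond i) (hcond' i)).ne',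
    Real.log_pow, Real.log_prod fun i _ => (hPW i).ne',
    Real.log_prod fun i _ => (mul_pos (hcond i) (hcond' i)).ne']
  simp only [Real.log_mul (hcond _).ne' (hcond' _).ne', Finset.sum_add_distrib]
  have s1 := sum_sum_empiricalDist_mul x y fun a b => Real.log (P a * W a b)
  have s2 := sum_sum_empiricalDist_mul x y fun a b => Real.log (q a b / ∑ a', q a' b)
  have s3 := sum_sum_empiricalDist_mul x (transform σ y)
    fun a b => Real.log (q' a b / ∑ b', q' a b')
  have hq1 : ∑ a, ∑ b, q a b = 1 := by
    have := sum_sum_empiricalDist_mul x y fun _ _ => 1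
    simpa [hn'.ne'] using this
  have hgibbs := sum_mul_log_le (fun a b => √(P a * W a b)) (fun _ _ => Real.sqrt_nonneg _) r hr
    hnorm q hqn hq1 (fun a b hab => by
      obtain ⟨i, rfl, rfl⟩ := (empiricalDist_pos_iff x y a b).1 hab
      exact Real.sqrt_pos.2 (hPW i))
  simp only [Real.sq_sqrt (mul_nonneg (hP _) (hW _ _))] at hgibbs
  have hmarg : ∀ b, ∑ a, q' a b = ∑ a, q a b := sum_empiricalDist_transform x y σ
  -- `-H(Y | X) = I(X; Y) - H(Y)` for the type `q'`, whose second marginal is that of `q`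
  have hchain : ∑ a, ∑ b, q' a b * Real.log (q' a b / ∑ b', q' a b')
      = mutualInfo q' + ∑ a, ∑ b, q a b * Real.log (∑ a', q a' b) := by
    have e1 : ∑ a, ∑ b, q a b * Real.log (∑ a', q a' b)
        = ∑ a, ∑ b, q' a b * Real.log (∑ a', q' a' b) := by
      rw [Finset.sum_comm, Finset.sum_comm (f := fun a b => q' a b * Real.log (∑ a', q' a' b))]
      simp only [← Finset.sum_mul, hmarg]
    rw [e1, mutualInfo, ← Finset.sum_add_distrib]
    refine Finset.sum_congr rfl fun a _ => ?_
    rw [← Finset.sum_add_distrib]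
    refine Finset.sum_congr rfl fun b _ => ?_
    rcases (hqn' a b).eq_or_lt with h | h
    · simp [← h]
    · have hX : 0 < ∑ b', q' a b' := h.trans_le
        (Finset.single_le_sum (f := fun b => q' a b) (fun _ _ => hqn' _ _) (Finset.mem_univ b))
      have hY : 0 < ∑ a', q' a' b := h.trans_le
        (Finset.single_le_sum (f := fun a => q' a b) (fun _ _ => hqn' _ _) (Finset.mem_univ a))
      rw [Real.log_div h.ne' hX.ne', Real.log_div h.ne' (by positivity),
        Real.log_mul hX.ne' hY.ne']
      ring
  have hMI' : mutualInfo q ≤ mutualInfo q' := hMI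
  rw [mutualInfo] at hMI'
  have hfin := hgibbs.trans (add_le_add_left (add_le_add_right hMI' _) _)
  rw [add_assoc, ← hchain, s1, s2, s3] at hfin
  have hfin' := mul_le_mul_of_nonneg_left hfin hn'.le
  rw [mul_add, mul_add] at hfin'
  simp only [← mul_assoc, mul_one_div_cancel hn'.ne', one_mul] at hfin'
  rw [← add_assoc]
  exact hfin'

/-- A finite set containing all joint types of images with `n` pixels. -/
noncomputable def jointTypes (𝒳 𝒴 : Type*) [Fintype 𝒳] [Fintype 𝒴] (n : ℕ) :
    Finset (𝒳 → 𝒴 → ℝ) := by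
  classical
  exact Finset.univ.image fun (k : 𝒳 → 𝒴 → Fin (n + 1)) a b => (1 / (n : ℝ)) * (k a b : ℕ)

lemma card_jointTypes_le (𝒳 𝒴 : Type*) [Fintype 𝒳] [Fintype 𝒴] (n : ℕ) :
    (jointTypes 𝒳 𝒴 n).card ≤ (n + 1) ^ (Fintype.card 𝒴 * Fintype.card 𝒳) := by
  classical
  refine Finset.card_image_le.trans_eq ?_
  simp [pow_mul]

lemma nonneg_of_mem_jointTypes {𝒳 𝒴 : Type*} [Fintype 𝒳] [Fintype 𝒴] {n : ℕ} {q : 𝒳 → 𝒴 → ℝ}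
    (hq : q ∈ jointTypes 𝒳 𝒴 n) (a : 𝒳) (b : 𝒴) : 0 ≤ q a b := by
  classical
  obtain ⟨k, -, rfl⟩ := Finset.mem_image.1 hq
  positivity

lemma empiricalDist_mem_jointTypes {𝒳 𝒴 : Type*} [Fintype 𝒳] [Fintype 𝒴] {n : ℕ}
    (x : Fin n → 𝒳) (y : Fin n → 𝒴) : empiricalDist x y ∈ jointTypes 𝒳 𝒴 n := by
  classical
  refine Finset.mem_image.2 ⟨fun a b => ⟨(Finset.univ.filter fun i => x i = a ∧ y i = b).card,
    Nat.lt_succ_of_le ((Finset.card_filter_le _ _).trans_eq (Finset.card_fin n))⟩,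
    Finset.mem_univ _, ?_⟩
  ext a b
  simp [empiricalDist, Finset.sum_boole]

/-- The steps `b → a → b'` with the conditional probabilities `q(a | b)` and `q'(b' | a)` form a
substochastic matrix. Conditioning on an event of probability zero yields `0`, which is harmless
here. -/
lemma permSum_cond_le {α β : Type*} [Fintype α] [Fintype β] [Nonempty β] {n : ℕ}
    (σ : Equiv.Perm (Fin n)) (R : Finset (Fin n)) (hR : ∀ i, ∃ k : ℕ, (σ ^ k) i ∈ R)
    (q q' : α → β → ℝ) (hq : ∀ a b, 0 ≤ q a b) (hq' : ∀ a b, 0 ≤ q' a b) :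
    permSum σ (fun b b' => ∑ a, q a b / (∑ a', q a' b) * (q' a b' / ∑ b'', q' a b''))
      ≤ (Fintype.card β : ℝ) ^ R.card := by
  have h1 : ∀ a b, 0 ≤ q a b / ∑ a', q a' b := fun a b =>
    div_nonneg (hq _ _) (Finset.sum_nonneg fun _ _ => hq _ _)
  have h2 : ∀ a b, 0 ≤ q' a b / ∑ b', q' a b' := fun a b =>
    div_nonneg (hq' _ _) (Finset.sum_nonneg fun _ _ => hq' _ _)
  refine permSum_le_card_pow σ _
    (fun b b' => Finset.sum_nonneg fun a _ => mul_nonneg (h1 _ _) (h2 _ _)) (fun b => ?_) R hR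
  rw [Finset.sum_comm]
  calc ∑ a, ∑ b', q a b / (∑ a', q a' b) * (q' a b' / ∑ b'', q' a b'')
      ≤ ∑ a, q a b / ∑ a', q a' b := by
        refine Finset.sum_le_sum fun a _ => ?_
        rw [← Finset.mul_sum, ← Finset.sum_div]
        exact mul_le_of_le_one_right (h1 _ _) (div_self_le_one _)
    _ ≤ 1 := by
        rw [← Finset.sum_div]
        exact div_self_le_one _

/-- Upper bound for the probability that `σ` scores at least as high as the identity in terms of
empirical mutual information. -/
lemma sum_prob_empiricalMI_le {𝒳 𝒴 : Type*} [Fintype 𝒳] [Fintype 𝒴] [Nonempty 𝒴] (P : 𝒳 → ℝ)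
    (hP : ∀ a, 0 ≤ P a) (W : 𝒳 → 𝒴 → ℝ) (hW : ∀ a b, 0 ≤ W a b) (r : ℝ) (hr : 0 < r)
    (hnorm : ∀ w : 𝒴 → ℝ, ∑ a, (∑ b, √(P a * W a b) * w b) ^ 2 ≤ r * ∑ b, w b ^ 2)
    {n : ℕ} (σ : Equiv.Perm (Fin n)) (R : Finset (Fin n)) (hR : ∀ i, ∃ k : ℕ, (σ ^ k) i ∈ R) :
    ∑ x : Fin n → 𝒳, ∑ y : Fin n → 𝒴, (if empiricalMI x y ≤ empiricalMI x (transform σ y) then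
      (∏ i, P (x i)) * likelihood W x y else 0) ≤
    r ^ n * ((n + 1 : ℝ) ^ (Fintype.card 𝒴 * Fintype.card 𝒳) *
      ((n + 1 : ℝ) ^ (Fintype.card 𝒴 * Fintype.card 𝒳) * (Fintype.card 𝒴 : ℝ) ^ R.card)) := by
  set F : (𝒳 → 𝒴 → ℝ) → (𝒳 → 𝒴 → ℝ) → (Fin n → 𝒳) → (Fin n → 𝒴) → ℝ := fun q q' x y =>
    ∏ i, (q (x i) (y i) / (∑ a, q a (y i)) * (q' (x i) (y (σ i)) / ∑ b, q' (x i) b)) with hF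
  have hFn : ∀ q ∈ jointTypes 𝒳 𝒴 n, ∀ q' ∈ jointTypes 𝒳 𝒴 n, ∀ x y, 0 ≤ F q q' x y := by
    intro q hq q' hq' x y
    have h1 := nonneg_of_mem_jointTypes hq
    have h2 := nonneg_of_mem_jointTypes hq'
    exact Finset.prod_nonneg fun i _ => mul_nonneg
      (div_nonneg (h1 _ _) (Finset.sum_nonneg fun _ _ => h1 _ _))
      (div_nonneg (h2 _ _) (Finset.sum_nonneg fun _ _ => h2 _ _))
  calc _ ≤ ∑ x : Fin n → 𝒳, ∑ y : Fin n → 𝒴, r ^ n *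
          ∑ q ∈ jointTypes 𝒳 𝒴 n, ∑ q' ∈ jointTypes 𝒳 𝒴 n, F q q' x y := by
        refine Finset.sum_le_sum fun x _ => Finset.sum_le_sum fun y _ => ?_
        have hnn : ∀ q ∈ jointTypes 𝒳 𝒴 n, 0 ≤ ∑ q' ∈ jointTypes 𝒳 𝒴 n, F q q' x y :=
          fun q hq => Finset.sum_nonneg fun q' hq' => hFn q hq q' hq' x y
        split_ifs with hMI
        · refine (prob_le_of_empiricalMI_le P hP W hW r hr hnorm σ x y hMI).trans
            (mul_le_mul_of_nonneg_left ?_ (by positivity))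
          have hm := empiricalDist_mem_jointTypes x y
          exact (Finset.single_le_sum (f := fun q' => F (empiricalDist x y) q' x y)
            (fun q' hq' => hFn _ hm q' hq' x y)
              (empiricalDist_mem_jointTypes x (transform σ y))).trans
            (Finset.single_le_sum
              (f := fun q => ∑ q' ∈ jointTypes 𝒳 𝒴 n, F q q' x y) hnn hm)
        · exact mul_nonneg (by positivity) (Finset.sum_nonneg hnn)
    _ = r ^ n * ∑ q ∈ jointTypes 𝒳 𝒴 n, ∑ q' ∈ jointTypes 𝒳 𝒴 n,
          ∑ x : Fin n → 𝒳, ∑ y : Fin n → 𝒴, F q q' x y := by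
        simp only [← Finset.mul_sum]
        congr 1
        simp_rw [Finset.sum_comm (s := (Finset.univ : Finset (Fin n → 𝒴)))
          (t := jointTypes 𝒳 𝒴 n)]
        rw [Finset.sum_comm]
        refine Finset.sum_congr rfl fun q _ => ?_
        rw [Finset.sum_comm]
    _ ≤ r ^ n * ∑ q ∈ jointTypes 𝒳 𝒴 n, ∑ q' ∈ jointTypes 𝒳 𝒴 n,
          (Fintype.card 𝒴 : ℝ) ^ R.card := by
        refine mul_le_mul_of_nonneg_left (Finset.sum_le_sum fun q hq =>
          Finset.sum_le_sum fun q' hq' => ?_) (by positivity)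
        exact (permSum_sum σ fun a b b' => q a b / (∑ a', q a' b) *
          (q' a b' / ∑ b'', q' a b'')).symm.trans_le (permSum_cond_le σ R hR q q'
            (nonneg_of_mem_jointTypes hq) (nonneg_of_mem_jointTypes hq'))
    _ ≤ _ := by
        simp only [Finset.sum_const, nsmul_eq_mul]
        have hc : ((jointTypes 𝒳 𝒴 n).card : ℝ)
            ≤ (n + 1 : ℝ) ^ (Fintype.card 𝒴 * Fintype.card 𝒳) := by
          exact_mod_cast card_jointTypes_le 𝒳 𝒴 n
        gcongr

/-! ### Error probabilities and exponents -/

lemma transform_transform {𝒴 : Type*} {n : ℕ} (π τ : Equiv.Perm (Fin n)) (y : Fin n → 𝒴) :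
    transform τ (transform π y) = transform (π * τ) y := rfl

open Classical in
/-- The error probability as the total posterior weight of the transformations which the rule does
not choose. -/
lemma errorProb_eq {𝒳 𝒴 : Type*} [Fintype 𝒳] [Fintype 𝒴] {n : ℕ}
    (P : 𝒳 → ℝ) (W : 𝒳 → 𝒴 → ℝ) (G : Subgroup (Equiv.Perm (Fin n))) (φ : Rule 𝒳 𝒴 n) :
    errorProb P W G φ = (1 / (Nat.card G : ℝ)) * ∑ x : Fin n → 𝒳, ∑ y : Fin n → 𝒴,
      (∏ i, P (x i)) * ∑ π : G, if φ x y ≠ π then likelihood W x (transform π y) else 0 := by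
  have h : ∀ (π : G) (x : Fin n → 𝒳), (∑ y' : Fin n → 𝒴, (∏ i, P (x i)) * likelihood W x y' *
      if φ x (transform (π : Equiv.Perm (Fin n)) y') ≠ (π : Equiv.Perm (Fin n))⁻¹ then (1 : ℝ)
        else 0)
      = ∑ y : Fin n → 𝒴, (∏ i, P (x i)) *
        if φ x y ≠ (π⁻¹ : G) then likelihood W x (transform (π⁻¹ : G) y) else 0 := by
    intro π x
    refine Fintype.sum_equiv ((π : Equiv.Perm (Fin n))⁻¹.arrowCongr (Equiv.refl 𝒴)) _ _
      fun y' => ?_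
    have e1 : ((π : Equiv.Perm (Fin n))⁻¹.arrowCongr (Equiv.refl 𝒴)) y'
        = transform (π : Equiv.Perm (Fin n)) y' := rfl
    have e2 : transform ((π⁻¹ : G) : Equiv.Perm (Fin n)) (transform (π : Equiv.Perm (Fin n)) y')
        = y' := by
      rw [transform_transform, Subgroup.coe_inv, mul_inv_cancel]
      rfl
    rw [e1, e2, mul_assoc, Subgroup.coe_inv]
    simp only [mul_ite, mul_one, mul_zero]
  rw [errorProb]
  simp only [h]
  rw [Finset.sum_comm]
  congr 1
  refine Finset.sum_congr rfl fun x _ => ?_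
  rw [Finset.sum_comm]
  refine Finset.sum_congr rfl fun y _ => ?_
  rw [← Finset.mul_sum]
  congr 1
  exact Equiv.sum_comp (Equiv.inv G)
    fun π : G => if φ x y ≠ π then likelihood W x (transform π y) else 0

/-- Maximum likelihood minimizes the error probability. -/
lemma errorProb_le_of_isML {𝒳 𝒴 : Type*} [Fintype 𝒳] [Fintype 𝒴] {n : ℕ}
    (P : 𝒳 → ℝ) (hP : ∀ a, 0 ≤ P a) (W : 𝒳 → 𝒴 → ℝ) (G : Subgroup (Equiv.Perm (Fin n)))
    (φ ψ : Rule 𝒳 𝒴 n) (hφ : IsML W G φ) (hψ : ∀ x y, ψ x y ∈ G) :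
    errorProb P W G φ ≤ errorProb P W G ψ := by
  classical
  have h : ∀ (χ : Rule 𝒳 𝒴 n) x y, χ x y ∈ G →
      (∑ π : G, if χ x y ≠ π then likelihood W x (transform π y) else 0)
        = ∑ π : G, likelihood W x (transform π y) - likelihood W x (transform (χ x y) y) := by
    intro χ x y hχ
    have e : ∀ π : G, (if χ x y ≠ π then likelihood W x (transform π y) else 0)
        = likelihood W x (transform π y) -
          if (⟨χ x y, hχ⟩ : G) = π then likelihood W x (transform π y) else 0 := by
      intro π
      by_cases hπ : χ x y = π
      · simp [hπ]
      · rw [if_pos hπ, if_neg fun h => hπ (congrArg Subtype.val h), sub_zero]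
    simp only [e, Finset.sum_sub_distrib]
    simp
  rw [errorProb_eq, errorProb_eq]
  refine mul_le_mul_of_nonneg_left (Finset.sum_le_sum fun x _ => Finset.sum_le_sum fun y _ =>
    mul_le_mul_of_nonneg_left ?_ (Finset.prod_nonneg fun i _ => hP _)) (by positivity)
  rw [h φ x y (hφ x y).1, h ψ x y (hψ x y)]
  linarith [(hφ x y).2 _ (hψ x y)]

/-- No rule decides both for `1` and for `σ` on the same pair of images. -/
lemma sum_min_likelihood_le_errorProb {𝒳 𝒴 : Type*} [Fintype 𝒳] [Fintype 𝒴] {n : ℕ}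
    (P : 𝒳 → ℝ) (hP : ∀ a, 0 ≤ P a) (W : 𝒳 → 𝒴 → ℝ) (hW : ∀ a b, 0 ≤ W a b)
    (G : Subgroup (Equiv.Perm (Fin n))) (φ : Rule 𝒳 𝒴 n) (σ : Equiv.Perm (Fin n)) (hσ : σ ∈ G)
    (hσ1 : σ ≠ 1) :
    (1 / (Nat.card G : ℝ)) * ∑ x : Fin n → 𝒳, ∑ y : Fin n → 𝒴,
      (∏ i, P (x i)) * min (likelihood W x y) (likelihood W x (transform σ y))
      ≤ errorProb P W G φ := by
  classical
  have hL : ∀ x y, 0 ≤ likelihood (n := n) W x y := fun x y => Finset.prod_nonneg fun i _ => hW _ _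
  rw [errorProb_eq]
  refine mul_le_mul_of_nonneg_left (Finset.sum_le_sum fun x _ => Finset.sum_le_sum fun y _ =>
    mul_le_mul_of_nonneg_left ?_ (Finset.prod_nonneg fun i _ => hP _)) (by positivity)
  have hle : ∀ π : G, φ x y ≠ π → likelihood W x (transform π y) ≤
      ∑ π : G, if φ x y ≠ π then likelihood W x (transform π y) else 0 := by
    intro π hπ
    refine le_trans (by rw [if_pos hπ]) (Finset.single_le_sum
      (f := fun π : G => if φ x y ≠ π then likelihood W x (transform π y) else 0)
      (fun π _ => ?_) (Finset.mem_univ π))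
    split_ifs
    · exact hL _ _
    · exact le_rfl
  by_cases h : φ x y = 1
  · exact (min_le_right _ _).trans (hle ⟨σ, hσ⟩ fun h' => hσ1 (h'.symm.trans h))
  · exact (min_le_left _ _).trans (hle 1 h)

/-- Union bound over the transformations that beat the true one. -/
lemma errorProb_le_of_isMMI {𝒳 𝒴 : Type*} [Fintype 𝒳] [Fintype 𝒴] {n : ℕ}
    (P : 𝒳 → ℝ) (hP : ∀ a, 0 ≤ P a) (W : 𝒳 → 𝒴 → ℝ) (hW : ∀ a b, 0 ≤ W a b)
    (G : Subgroup (Equiv.Perm (Fin n))) (φ : Rule 𝒳 𝒴 n) (hφ : IsMMI G φ) (B : ℝ) (hB0 : 0 ≤ B)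
    (hB : ∀ σ ∈ G, σ ≠ 1 → ∑ x : Fin n → 𝒳, ∑ y : Fin n → 𝒴,
      (if empiricalMI x y ≤ empiricalMI x (transform σ y) then
        (∏ i, P (x i)) * likelihood W x y else 0) ≤ B) :
    errorProb P W G φ ≤ Nat.card G * B := by
  classical
  have hpt : ∀ (π : G) (x : Fin n → 𝒳) (y : Fin n → 𝒴), ((∏ i, P (x i)) * likelihood W x y *
      if φ x (transform (π : Equiv.Perm (Fin n)) y) ≠ (π : Equiv.Perm (Fin n))⁻¹ then (1 : ℝ)
        else 0)
      ≤ ∑ σ : G, if (σ : Equiv.Perm (Fin n)) ≠ 1 then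
          (if empiricalMI x y ≤ empiricalMI x (transform σ y) then
            (∏ i, P (x i)) * likelihood W x y else 0) else 0 := by
    intro π x y
    have hw : 0 ≤ (∏ i, P (x i)) * likelihood W x y := mul_nonneg
      (Finset.prod_nonneg fun i _ => hP _) (Finset.prod_nonneg fun i _ => hW _ _)
    have hnn : ∀ σ : G, 0 ≤ if (σ : Equiv.Perm (Fin n)) ≠ 1 then
          (if empiricalMI x y ≤ empiricalMI x (transform σ y) then
            (∏ i, P (x i)) * likelihood W x y else 0) else 0 := by
      intro σ
      split_ifs
      exacts [hw, le_rfl, le_rfl]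
    split_ifs with he
    · -- the composition of the true transformation with the decision is a nontrivial `σ`
      obtain ⟨hmem, hmax⟩ := hφ x (transform (π : Equiv.Perm (Fin n)) y)
      set τ := φ x (transform (π : Equiv.Perm (Fin n)) y)
      have hne : (π : Equiv.Perm (Fin n)) * τ ≠ 1 := fun h => he (eq_inv_of_mul_eq_one_right h)
      have hMI := hmax _ (G.inv_mem π.2)
      rw [transform_transform, transform_transform, mul_inv_cancel] at hMI
      change empiricalMI x y ≤ empiricalMI x (transform (π * τ) y) at hMI
      refine le_trans ?_ (Finset.single_le_sum (fun σ _ => hnn σ)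
        (Finset.mem_univ (⟨π * τ, G.mul_mem π.2 hmem⟩ : G)))
      rw [if_pos hne, if_pos hMI, mul_one]
    · rw [mul_zero]
      exact Finset.sum_nonneg fun σ _ => hnn σ
  have hsum : ∀ π : G, ∑ x : Fin n → 𝒳, ∑ y : Fin n → 𝒴, ((∏ i, P (x i)) * likelihood W x y *
      if φ x (transform (π : Equiv.Perm (Fin n)) y) ≠ (π : Equiv.Perm (Fin n))⁻¹ then (1 : ℝ)
        else 0) ≤ Nat.card G * B := by
    intro π
    refine (Finset.sum_le_sum fun x _ => Finset.sum_le_sum fun y _ => hpt π x y).trans ?_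
    simp_rw [Finset.sum_comm (s := (Finset.univ : Finset (Fin n → 𝒴)))
      (t := (Finset.univ : Finset G))]
    rw [Finset.sum_comm, Nat.card_eq_fintype_card, ← nsmul_eq_mul, ← Finset.card_univ,
      ← Finset.sum_const]
    refine Finset.sum_le_sum fun σ _ => ?_
    by_cases hσ : (σ : Equiv.Perm (Fin n)) = 1
    · simpa [hσ] using hB0
    · simpa only [ne_eq, hσ, not_false_eq_true, if_true] using hB σ σ.2 hσ
  have hcard : (0 : ℝ) < Nat.card G := by exact_mod_cast Nat.card_pos
  rw [errorProb, one_div, inv_mul_le_iff₀ hcard]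
  refine (Finset.sum_le_sum fun π _ => hsum π).trans_eq ?_
  rw [Finset.sum_const, nsmul_eq_mul, Finset.card_univ, Nat.card_eq_fintype_card]

lemma hasErrorExponent_of_eventually_bounds {Pe : ℕ → ℝ} {E : ℝ}
    (h : ∀ ε > 0, ∀ᶠ n : ℕ in atTop, Real.exp (-((E + ε) * n)) ≤ Pe n ∧
      Pe n ≤ Real.exp (-((E - ε) * n))) : HasErrorExponent Pe E := by
  refine ⟨(h 1 one_pos).mono fun n hn => (Real.exp_pos _).trans_le hn.1, ?_⟩
  rw [Metric.tendsto_nhds]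
  intro ε hε
  filter_upwards [h (ε / 2) (by positivity), eventually_gt_atTop 0] with n hn hn0
  have hn0' : (0 : ℝ) < n := by exact_mod_cast hn0
  have hpos : 0 < Pe n := (Real.exp_pos _).trans_le hn.1
  have h1 := Real.log_le_log (Real.exp_pos _) hn.1
  have h2 := Real.log_le_log hpos hn.2
  rw [Real.log_exp] at h1 h2
  have h3 : -(1 / (n : ℝ)) * Real.log (Pe n) = -Real.log (Pe n) / n := by ring
  rw [h3, Real.dist_eq, abs_lt]
  constructor
  · rw [lt_sub_iff_add_lt, lt_div_iff₀ hn0']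
    nlinarith
  · rw [sub_lt_iff_lt_add, div_lt_iff₀ hn0']
    nlinarith

lemma eventually_mul_pow_le_exp (C : ℝ) (k : ℕ) (δ : ℝ) (hδ : 0 < δ) :
    ∀ᶠ n : ℕ in atTop, C * (n + 1 : ℝ) ^ k ≤ Real.exp (δ * n) := by
  have h := ((isLittleO_pow_exp_pos_mul_atTop k hδ).comp_tendsto
    (tendsto_natCast_atTop_atTop.comp (tendsto_add_atTop_nat 1))).def
    (show 0 < 1 / ((|C| + 1) * Real.exp δ) by positivity)
  filter_upwards [h] with n hn
  simp only [Function.comp_apply, Nat.cast_add, Nat.cast_one, Real.norm_eq_abs, Real.abs_exp] at hn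
  rw [abs_of_nonneg (by positivity), div_mul_eq_mul_div, one_mul, le_div_iff₀ (by positivity),
    mul_add, Real.exp_add, mul_one, ← mul_assoc] at hn
  have h2 := le_of_mul_le_mul_right hn (Real.exp_pos δ)
  have h3 : C * (n + 1 : ℝ) ^ k ≤ (|C| + 1) * (n + 1 : ℝ) ^ k :=
    mul_le_mul_of_nonneg_right (by linarith [le_abs_self C]) (by positivity)
  linarith

lemma eventually_pow_cycles_le_exp (G : (n : ℕ) → Subgroup (Equiv.Perm (Fin n)))
    (hcycles : ∀ ε : ℝ, 0 < ε → ∀ᶠ n : ℕ in atTop, ∀ π ∈ G n, π ≠ 1 →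
      (numCycles π : ℝ) ≤ ε * ((n : ℝ) / Real.log n))
    (hidentity : ∀ ε : ℝ, 0 < ε → ∀ᶠ n : ℕ in atTop, ∀ π ∈ G n, π ≠ 1 →
      (identityBlockSize π : ℝ) ≤ ε * n) (c : ℝ) (hc : 1 ≤ c) (δ : ℝ) (hδ : 0 < δ) :
    ∀ᶠ n : ℕ in atTop, ∀ π ∈ G n, π ≠ 1 →
      c ^ (numCycles π + identityBlockSize π) ≤ Real.exp (δ * n) := by
  have hl : 0 ≤ Real.log c := Real.log_nonneg hc
  set ε := δ / (2 * (Real.log c + 1)) with hε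
  have hε0 : 0 < ε := by positivity
  filter_upwards [hcycles ε hε0, hidentity ε hε0,
    (Real.tendsto_log_atTop.comp tendsto_natCast_atTop_atTop).eventually_ge_atTop 1]
    with n h1 h2 h3 π hπ hne
  simp only [Function.comp_apply] at h3
  have h4 : (numCycles π : ℝ) ≤ ε * n := (h1 π hπ hne).trans
    (mul_le_mul_of_nonneg_left (div_le_self (by positivity) h3) hε0.le)
  rw [← Real.exp_log (zero_lt_one.trans_le hc), ← Real.exp_nat_mul, Real.exp_le_exp, Nat.cast_add]
  calc ((numCycles π : ℝ) + identityBlockSize π) * Real.log c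
      ≤ (ε * n + ε * n) * (Real.log c + 1) :=
        mul_le_mul (add_le_add h4 (h2 π hπ hne)) (by linarith) hl (by positivity)
    _ = δ * n := by rw [hε]; field_simp; ring

end ImageRegistration

open ImageRegistration

theorem mainTheorem1 {𝒳 𝒴 : Type*} [Fintype 𝒳] [Fintype 𝒴]
    -- law of the pixels of the reference image, and the memoryless channel
    (P : 𝒳 → ℝ) (hP : P ∈ stdSimplex ℝ 𝒳)
    (W : 𝒳 → 𝒴 → ℝ) (hW : ∀ a, W a ∈ stdSimplex ℝ 𝒴)
    -- the allowed transformations of images with `n` pixels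
    (G : (n : ℕ) → Subgroup (Equiv.Perm (Fin n)))
    (hcomm : ∀ n, ∀ π ∈ G n, ∀ π' ∈ G n, π * π' = π' * π)
    (hnontrivial : ∀ᶠ n in atTop, G n ≠ ⊥)
    (hpoly : ∃ α : ℕ, (fun n : ℕ => (Nat.card (G n) : ℝ)) =O[atTop] fun n : ℕ => (n : ℝ) ^ α)
    (hcycles : ∀ ε : ℝ, 0 < ε → ∀ᶠ n : ℕ in atTop, ∀ π ∈ G n, π ≠ 1 →
      (ImageRegistration.numCycles π : ℝ) ≤ ε * ((n : ℝ) / Real.log n))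
    (hidentity : ∀ ε : ℝ, 0 < ε → ∀ᶠ n : ℕ in atTop, ∀ π ∈ G n, π ≠ 1 →
      (ImageRegistration.identityBlockSize π : ℝ) ≤ ε * n)
    -- the two registration rules, with arbitrary tie-breaking
    (φMMI φML : (n : ℕ) → ImageRegistration.Rule 𝒳 𝒴 n)
    (hMMI : ∀ n, ImageRegistration.IsMMI (G n) (φMMI n))
    (hML : ∀ n, ImageRegistration.IsML W (G n) (φML n)) :
    ∃ E : ℝ,
      ImageRegistration.HasErrorExponent
        (fun n => ImageRegistration.errorProb P W (G n) (φMMI n)) E ∧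
      ImageRegistration.HasErrorExponent
        (fun n => ImageRegistration.errorProb P W (G n) (φML n)) E := by
  have hP0 : ∀ a, 0 ≤ P a := hP.1
  have hW0 : ∀ a b, 0 ≤ W a b := fun a => (hW a).1
  have : Nonempty 𝒳 := by
    by_contra hne
    rw [not_nonempty_iff] at hne
    simpa using hP.2
  have : Nonempty 𝒴 := by
    by_contra hne
    rw [not_nonempty_iff] at hne
    simpa using (hW (Classical.arbitrary 𝒳)).2
  obtain ⟨r, v, hv, hv1, heig, hnorm⟩ :=
    exists_perron (fun a b => √(P a * W a b)) (fun _ _ => Real.sqrt_nonneg _)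
  -- the columns of `K` have squared norms at most `r`, and these sum to one
  have hr : 0 < r := by
    by_contra! hr0
    have hone : ∑ a, ∑ b, P a * W a b = 1 := by
      simp only [← Finset.mul_sum, (hW _).2, mul_one, hP.2]
    have hle : ∀ b, ∑ a, P a * W a b ≤ 0 := by
      classical
      intro b
      have := hnorm (Pi.single b 1)
      simp only [Pi.single_apply, mul_ite, mul_one, mul_zero, Finset.sum_ite_eq', Finset.mem_univ,
        if_true, ite_pow, one_pow, ne_eq, OfNat.ofNat_ne_zero, not_false_eq_true, zero_pow,
        Real.sq_sqrt (mul_nonneg (hP0 _) (hW0 _ _))] at this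
      linarith
    rw [Finset.sum_comm] at hone
    linarith [Finset.sum_nonpos fun b (_ : b ∈ Finset.univ) => hle b]
  have hcard : (1 : ℝ) ≤ Fintype.card 𝒴 := by exact_mod_cast Fintype.card_pos
  have hrpow : ∀ n : ℕ, r ^ n = Real.exp (Real.log r * n) := fun n => by
    rw [mul_comm, Real.exp_nat_mul, Real.exp_log hr]
  have hcyc := eventually_pow_cycles_le_exp G hcycles hidentity _ hcard
  obtain ⟨α, hα⟩ := hpoly
  obtain ⟨C, hC⟩ := hα.bound
  have hG : ∀ᶠ n : ℕ in atTop, (Nat.card (G n) : ℝ) ≤ |C| * (n + 1 : ℝ) ^ α := by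
    filter_upwards [hC] with n hn
    simp only [Real.norm_eq_abs, Nat.abs_cast, abs_pow] at hn
    refine hn.trans (mul_le_mul (le_abs_self C) ?_ (by positivity) (abs_nonneg _))
    exact pow_le_pow_left₀ (by positivity) (by linarith) _
  have hupper : ∀ ε > 0, ∀ᶠ n : ℕ in atTop,
      errorProb P W (G n) (φMMI n) ≤ Real.exp (-((-Real.log r - ε) * n)) := by
    intro ε hε
    filter_upwards [hG, hcyc (ε / 2) (by positivity),
      eventually_mul_pow_le_exp |C| (α + 2 * (Fintype.card 𝒴 * Fintype.card 𝒳)) (ε / 2)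
        (by positivity)] with n h1 h2 h3
    refine (errorProb_le_of_isMMI P hP0 W hW0 (G n) (φMMI n) (hMMI n)
      (r ^ n * ((n + 1 : ℝ) ^ (Fintype.card 𝒴 * Fintype.card 𝒳) *
        ((n + 1 : ℝ) ^ (Fintype.card 𝒴 * Fintype.card 𝒳) * Real.exp (ε / 2 * n))))
      (by positivity) fun σ hσ hσ1 => ?_).trans ?_
    · obtain ⟨R, hRcard, hR⟩ := exists_orbit_transversal σ
      refine (sum_prob_empiricalMI_le P hP0 W hW0 r hr hnorm σ R hR).trans ?_
      have := (pow_le_pow_right₀ hcard hRcard).trans (h2 σ hσ hσ1)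
      gcongr
    · set K := Fintype.card 𝒴 * Fintype.card 𝒳
      calc (Nat.card (G n) : ℝ) * (r ^ n * ((n + 1 : ℝ) ^ K *
            ((n + 1 : ℝ) ^ K * Real.exp (ε / 2 * n))))
          ≤ (|C| * (n + 1 : ℝ) ^ α) * (r ^ n * ((n + 1 : ℝ) ^ K *
            ((n + 1 : ℝ) ^ K * Real.exp (ε / 2 * n)))) :=
            mul_le_mul_of_nonneg_right h1 (by positivity)
        _ = (|C| * (n + 1 : ℝ) ^ (α + 2 * K)) * (r ^ n * Real.exp (ε / 2 * n)) := by ring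
        _ ≤ Real.exp (ε / 2 * n) * (r ^ n * Real.exp (ε / 2 * n)) :=
            mul_le_mul_of_nonneg_right h3 (by positivity)
        _ = Real.exp (-((-Real.log r - ε) * n)) := by
            rw [hrpow, ← Real.exp_add, ← Real.exp_add]
            congr 1
            ring
  have hlower : ∀ φ : (n : ℕ) → Rule 𝒳 𝒴 n, ∀ ε > 0, ∀ᶠ n : ℕ in atTop,
      Real.exp (-((-Real.log r + ε) * n)) ≤ errorProb P W (G n) (φ n) := by
    intro φ ε hε
    obtain ⟨t, ht, hlow⟩ := exists_le_sum_min_likelihood P hP0 W hW0 r hr v hv hv1 heig (ε / 2)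
      (by positivity)
    filter_upwards [hG, hnontrivial, hcyc (t / 2) (by positivity),
      eventually_mul_pow_le_exp (2 * |C|) α (ε / 2) (by positivity),
      eventually_mul_pow_le_exp 4 0 (t / 2) (by positivity)] with n h1 h2 h3 h4 h5
    obtain ⟨σ, hσ, hσ1⟩ := (G n).bot_or_exists_ne_one.resolve_left h2
    obtain ⟨R, hRcard, hR⟩ := exists_orbit_transversal σ
    refine le_trans ?_ (sum_min_likelihood_le_errorProb P hP0 W hW0 (G n) (φ n) σ hσ hσ1)
    have hpos : (0 : ℝ) < Nat.card (G n) := by exact_mod_cast Nat.card_pos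
    rw [one_div, le_inv_mul_iff₀ hpos]
    refine le_trans ?_ (hlow n σ R hR)
    have hY := (pow_le_pow_right₀ hcard hRcard).trans (h3 σ hσ hσ1)
    -- the factor `exp (t n / 2)` allowed for the cycles uses up half of the decay `exp (-t n)`
    have hhalf : (1 : ℝ) / 2 ≤ 1 - 2 * (Real.exp (-(t * n)) * (Fintype.card 𝒴 : ℝ) ^ R.card) := by
      have e1 : Real.exp (-(t * n)) * (Real.exp (t / 2 * n) * Real.exp (t / 2 * n)) = 1 := by
        rw [← Real.exp_add, ← Real.exp_add, Real.exp_eq_one_iff]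
        ring
      have e2 := mul_le_mul_of_nonneg_left hY (Real.exp_pos (-(t * n))).le
      have e3 : Real.exp (-(t * n)) * (Real.exp (t / 2 * n) * 4) ≤
          Real.exp (-(t * n)) * (Real.exp (t / 2 * n) * Real.exp (t / 2 * n)) := by
        gcongr
        simpa using h5
      linarith
    have hsplit : Real.exp (-((-Real.log r + ε) * n))
        = Real.exp (-(ε / 2 * n)) * (r ^ n * Real.exp (-(ε / 2 * n))) := by
      rw [hrpow, ← Real.exp_add, ← Real.exp_add]
      congr 1
      ring
    have hcardG : (Nat.card (G n) : ℝ) * Real.exp (-(ε / 2 * n)) ≤ 1 / 2 := by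
      have e4 : 2 * (Nat.card (G n) : ℝ) ≤ Real.exp (ε / 2 * n) := by linarith
      rw [Real.exp_neg, ← div_eq_mul_inv, div_le_iff₀ (Real.exp_pos _)]
      linarith
    calc (Nat.card (G n) : ℝ) * Real.exp (-((-Real.log r + ε) * n))
        = Real.exp (-(ε / 2 * n)) * (r ^ n * (Nat.card (G n) * Real.exp (-(ε / 2 * n)))) := by
          rw [hsplit]; ring
      _ ≤ _ := by
          gcongr
          exact hcardG.trans hhalf
  refine ⟨-Real.log r, hasErrorExponent_of_eventually_bounds fun ε hε => ?_,
    hasErrorExponent_of_eventually_bounds fun ε hε => ?_⟩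
  · exact (hlower φMMI ε hε).and (hupper ε hε)
  · filter_upwards [hlower φML ε hε, hupper ε hε] with n h1 h2
    exact ⟨h1, (errorProb_le_of_isML P hP0 W (G n) (φML n) (φMMI n) (hML n)
      fun x y => (hMMI n x y).1).trans h2⟩
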